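/- **Proposition 4.1.** *Conventions.* A chord diagram with $n$ chords is a set of pairs (chords) $(a_1,b_1),\dots,(a_n,b_n)$ with $a_i<b_i$ and $\{a_1,b_1,\dots,a_n,b_n\}=\{1,\dots,2n\}$. Two chords $(a,b)$, $(a',b')$ intersect if $a<a'<b<b'$ or $a'<a<b'<b$; a diagram is connected if it is nonempty and its intersection graph is connected. A chord $(a,b)$ is terminal if every chord $(c,d)$ intersecting it satisfies $c<a$. The intersection order of a connected diagram lists first the chord containing $1$ (the root), then, after deletion of the root, the chords of the connected components of what remains, components being taken by increasing leftmost endpoint and each being ordered recursively in the same way; chords are identified with their positions $1,2,\dots$ in this order. Label successively, for $c=1,2,\dots$, all intervals between consecutive dots lying below chord $c$ by $c$, replacing previous labels; $\omega(c)$ is the final number of intervals labelled $c$, minus $1$. A decorated diagram $C$ carries a positive integer $d(c)$ on each chord $c$; its size is $\|C\|=\sum_c d(c)$, and for a positive integer $s$ its weight is $w(C)=\prod_c\binom{d(c)s+\omega(c)-2}{\omega(c)}$. The weighted generating function of a family $\mathcal A$ of connected decorated diagrams is the formal power series $\sum_{C\in\mathcal A}w(C)\frac{z^{\|C\|}}{\|C\|!}$.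 Let $t_1(C)<\dots<t_\ell(C)$ be the positions of the terminal chords of $C$. The type of $C$ is the triple formed by $d(t_1(C))$, the multiset of the pairs $(d(t_j(C)),t_j(C)-t_{j-1}(C))$ for $2\le j\le\ell$, and the multiset of the decorations $\ne1$ of non-terminal chords; $F_{\Delta,\mathcal G,\mathcal D}$ is the weighted generating function of the connected diagrams of type $(\Delta,\mathcal G,\mathcal D)$. The series $\sqrt{1+cz}$ is the formal power series with constant term $1$ and square $1+cz$. Let $K$ be a field of characteristic $0$ and let $a_{k,i}\in K$ ($k\ge1$, $i\ge0$) be arbitrary; put $F_k(\rho)=\sum_{i\ge0}a_{k,i}\rho^{i-1}$. For $G(x,L)\in K[L][[x]]$ write $G(x,L)=1+\sum_{i,n}g_{i,n}L^ix^n$; its leading-log expansion is $H_0(z)=\sum_{i\ge0}g_{i,i}z^i$. *Statement.* Let $s=2$. 1. The weighted generating function of the connected decorated diagrams with exactly one terminal chord and no chord of decoration $\ge2$ is $F_{1,\varnothing,\varnothing}(z)$, and $$F_{1,\varnothing,\varnothing}(z)=1-\sqrt{1-2z}.$$ 2. Consequently, the leading-log expansion for $s=2$ is $$H_0(z)=\sqrt{1+2a_{1,0}z}-1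 .$$ This holds for the Green function $G$, that is, the unique invertible $G\in K[L][[x]]$ satisfying the Dyson–Schwinger equation $$G(x,L)=1-\sum_{k\ge1}x^k\,G(x,\partial_{-\rho})^{1-sk}(e^{-L\rho}-1)F_k(\rho)\Big|_{\rho=0}$$ (which has exactly one such solution), and likewise for the chord diagram expansion $$G(x,L)=1-\sum_{C}\Big(\sum_{i=1}^{t_1(C)}a_{d(t_1(C)),\,t_1(C)-i}\frac{(-L)^i}{i!}\Big)w(C)A(C)x^{\|C\|},$$ where $C$ runs over all connected decorated diagrams and $A(C)=\prod_{c\text{ not terminal}}a_{d(c),0}\prod_{j=2}^{\ell}a_{d(t_j(C)),\,t_j(C)-t_{j-1}(C)}$. -/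

import Mathlib

namespace ChordLog

/-! ### Chord diagrams -/

/-- A chord diagram: a finite set of pairs `(a, b)` with `a < b`, whose endpoints are exactly the
dots `1, …, 2n`, where `n` is the number of pairs (so that all `2n` endpoints are distinct). -/
@[ext] structure ChordDiagram where
  chords : Finset (ℕ × ℕ)
  lt : ∀ c ∈ chords, c.1 < c.2
  endpoints : chords.image Prod.fst ∪ chords.image Prod.snd = Finset.Icc 1 (2 * chords.card)

/-- There is a directed edge from `c = (a, b)` to `d = (a', b')` when `a < a' < b < b'`. -/
def Crosses (c d : ℕ × ℕ) : Prop := c.1 < d.1 ∧ d.1 < c.2 ∧ c.2 < d.2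

/-- The (undirected) intersection graph of a finite set `S` of chords. For convenience the vertex
set is all of `ℕ × ℕ`; pairs outside `S` are isolated. -/
def intersectionGraph (S : Finset (ℕ × ℕ)) : SimpleGraph (ℕ × ℕ) where
  Adj c d := c ∈ S ∧ d ∈ S ∧ (Crosses c d ∨ Crosses d c)
  symm := ⟨fun _ _ h => ⟨h.2.1, h.1, h.2.2.symm⟩⟩
  loopless := ⟨fun c h => by
    rcases h.2.2 with h | h <;> exact lt_irrefl _ h.1⟩

open Classical in
/-- The connected component of `r` in the set of chords `S`, as a set of chords. -/
noncomputable def component (S : Finset (ℕ × ℕ)) (r : ℕ × ℕ) : Finset (ℕ × ℕ) :=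
  S.filter fun d => (intersectionGraph S).Reachable r d

/-- The chord of `S` with the leftmost first endpoint (unique if `S` consists of chords of a
diagram). -/
noncomputable def leftmost (S : Finset (ℕ × ℕ)) (h : S.Nonempty) : ℕ × ℕ :=
  (S.exists_min_image Prod.fst h).choose

theorem leftmost_mem (S : Finset (ℕ × ℕ)) (h : S.Nonempty) : leftmost S h ∈ S :=
  (S.exists_min_image Prod.fst h).choose_spec.1

theorem leftmost_mem_component (S : Finset (ℕ × ℕ)) (h : S.Nonempty) :
    leftmost S h ∈ component S (leftmost S h) := by
  classical
  exact Finset.mem_filter.2 ⟨leftmost_mem S h, SimpleGraph.Reachable.refl _⟩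

theorem component_subset (S : Finset (ℕ × ℕ)) (r : ℕ × ℕ) : component S r ⊆ S := by
  classical
  exact Finset.filter_subset _ _

/-- The chords of `S` listed in intersection order. The connected components of `S` are listed one
after the other, ordered by their leftmost endpoint; inside a component with leftmost chord (root)
`r`, the chord `r` comes first, followed by the components of what remains after deleting `r`,
recursively in the same order. -/
noncomputable def intersectionOrder (S : Finset (ℕ × ℕ)) : List (ℕ × ℕ) :=
  if h : S.Nonempty then
    leftmost S h ::
      (intersectionOrder ((component S (leftmost S h)).erase (leftmost S h)) ++
        intersectionOrder (S \ component S (leftmost S h)))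
  else []
termination_by S.card
decreasing_by
  · exact (Finset.card_erase_lt_of_mem (leftmost_mem_component S h)).trans_le
      (Finset.card_le_card (component_subset S _))
  · exact Finset.card_lt_card (Finset.sdiff_ssubset (component_subset S _)
      ⟨_, leftmost_mem_component S h⟩)

namespace ChordDiagram

variable (C : ChordDiagram)

/-- A diagram is connected if it is nonempty and its intersection graph is (weakly) connected. -/
def IsConnected : Prop :=
  C.chords.Nonempty ∧ ∀ c ∈ C.chords, ∀ d ∈ C.chords, (intersectionGraph C.chords).Reachable c d

/-- The chords in intersection order. -/
noncomputable def order : List (ℕ × ℕ) := intersectionOrder C.chords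

/-- The position of a chord in the intersection order; positions start at `1`. -/
noncomputable def pos (c : ℕ × ℕ) : ℕ := C.order.idxOf c + 1

/-- A chord is terminal if every chord intersecting it has a smaller first endpoint. -/
def IsTerminal (c : ℕ × ℕ) : Prop :=
  c ∈ C.chords ∧ ∀ d ∈ C.chords, (Crosses c d ∨ Crosses d c) → d.1 < c.1

open Classical in
/-- The terminal chords, listed in intersection order. -/
noncomputable def terminals : List (ℕ × ℕ) := C.order.filter fun c => C.IsTerminal c

/-- The first terminal chord in intersection order (every nonempty diagram has one). -/
noncomputable def firstTerminal : ℕ × ℕ := C.terminals.headD (0, 0)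

open Classical in
/-- The intervals covered by the chord `c`. The interval between the dots `i` and `i + 1` is
represented by `i ∈ {1, …, 2n - 1}`; it is below the chord `d` when `d.1 ≤ i < d.2`, and it carries
the label of the last chord, in intersection order, that it is below of. -/
noncomputable def covered (c : ℕ × ℕ) : Finset ℕ :=
  (Finset.Ico 1 (2 * C.chords.card)).filter fun i =>
    (c.1 ≤ i ∧ i < c.2) ∧ ∀ d ∈ C.chords, d.1 ≤ i → i < d.2 → C.pos d ≤ C.pos c

/-- The covering number: the number of covered intervals minus `1` (in a connected diagram
each chord covers at least one interval). -/
noncomputable def coveringNumber (c : ℕ × ℕ) : ℕ := (C.covered c).card - 1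

end ChordDiagram

/-! ### Decorated diagrams -/

/-- A decorated chord diagram: each chord carries a positive integer. The decoration is a function
on all pairs, normalised to be `0` off the diagram, so that it is a function of the chords only. -/
@[ext] structure DecoratedDiagram extends ChordDiagram where
  deco : ℕ × ℕ → ℕ
  deco_pos : ∀ c ∈ chords, 0 < deco c
  deco_eq_zero : ∀ c ∉ chords, deco c = 0

namespace DecoratedDiagram

/-- The size `‖C‖`: the sum of the decorations. -/
def size (C : DecoratedDiagram) : ℕ := ∑ c ∈ C.chords, C.deco c

theorem card_le_size (C : DecoratedDiagram) : C.chords.card ≤ C.size := by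
  have h := Finset.card_nsmul_le_sum C.chords C.deco 1 (fun c hc => C.deco_pos c hc)
  simpa [size] using h

theorem mem_Icc_of_mem (C : DecoratedDiagram) {c : ℕ × ℕ} (hc : c ∈ C.chords) :
    c.1 < 2 * C.size + 1 ∧ c.2 < 2 * C.size + 1 := by
  have h1 : c.1 ∈ Finset.Icc 1 (2 * C.chords.card) := by
    rw [← C.endpoints]
    exact Finset.mem_union_left _ (Finset.mem_image_of_mem _ hc)
  have h2 : c.2 ∈ Finset.Icc 1 (2 * C.chords.card) := by
    rw [← C.endpoints]
    exact Finset.mem_union_right _ (Finset.mem_image_of_mem _ hc)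
  have := C.card_le_size
  simp only [Finset.mem_Icc] at h1 h2
  omega

theorem mem_chords_iff (C : DecoratedDiagram) (c : ℕ × ℕ) : c ∈ C.chords ↔ C.deco c ≠ 0 :=
  ⟨fun h => (C.deco_pos c h).ne', fun h => by
    by_contra h'
    exact h (C.deco_eq_zero c h')⟩

/-- There are finitely many decorated diagrams of a given size. -/
theorem finite_size (n : ℕ) : {C : DecoratedDiagram | C.size = n}.Finite := by
  let f : {C : DecoratedDiagram | C.size = n} → Fin (2 * n + 1) × Fin (2 * n + 1) → Fin (n + 1) :=
    fun C p => ⟨C.1.deco (p.1, p.2), by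
      have hC : C.1.size = n := C.2
      by_cases h : ((p.1 : ℕ), (p.2 : ℕ)) ∈ C.1.chords
      · have := Finset.single_le_sum (f := C.1.deco) (fun i _ => Nat.zero_le _) h
        have h' : C.1.deco ((p.1 : ℕ), (p.2 : ℕ)) ≤ C.1.size := this
        omega
      · rw [C.1.deco_eq_zero _ h]
        omega⟩
  have hf : Function.Injective f := by
    rintro ⟨C, hC⟩ ⟨D, hD⟩ h
    have hC' : C.size = n := hC
    have hD' : D.size = n := hD
    have hdeco : C.deco = D.deco := by
      funext c
      by_cases hc : c.1 < 2 * n + 1 ∧ c.2 < 2 * n + 1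
      · have := congrFun h (⟨c.1, hc.1⟩, ⟨c.2, hc.2⟩)
        simpa [f] using this
      · rw [C.deco_eq_zero c, D.deco_eq_zero c]
        · intro h'
          exact hc (hD' ▸ D.mem_Icc_of_mem h')
        · intro h'
          exact hc (hC' ▸ C.mem_Icc_of_mem h')
    have hch : C.chords = D.chords := by
      ext c
      rw [mem_chords_iff, mem_chords_iff, hdeco]
    exact Subtype.ext (DecoratedDiagram.ext hch hdeco)
  exact Finite.of_injective f hf

/-- The diagrams of size `n` in the family `A`, as a finset. -/
noncomputable def ofSize (A : Set DecoratedDiagram) (n : ℕ) : Finset DecoratedDiagram :=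
  ((finite_size n).subset (Set.inter_subset_right (s := A))).toFinset

/-- The weight `w(C) = ∏ binom(d(c) s + ω(c) - 2, ω(c))`. The truncated subtraction only matters for
`s = 1`, `d(c) = 1`, `ω(c) = 0`, where both `binom(-1, 0)` and `binom(0, 0)` are `1`. -/
noncomputable def weight (s : ℕ) (C : DecoratedDiagram) : ℕ :=
  ∏ c ∈ C.chords, (C.deco c * s + C.coveringNumber c - 2).choose (C.coveringNumber c)

/-- The position `t₁(C)` of the first terminal chord. -/
noncomputable def t₁ (C : DecoratedDiagram) : ℕ := C.pos C.firstTerminal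

open Classical in
/-- `A(C)`: the product of `a_{d(c), 0}` over the non-terminal chords, times the product of
`a_{d(t_j), t_j - t_{j-1}}` over `j = 2, …, ℓ`, where `t_1 < ⋯ < t_ℓ` are the terminal chords. -/
noncomputable def monomialA {K : Type*} [Field K] (a : ℕ → ℕ → K) (C : DecoratedDiagram) : K :=
  (∏ c ∈ C.chords.filter (fun c => ¬ C.IsTerminal c), a (C.deco c) 0) *
    (List.zipWith (fun c c' => a (C.deco c') (C.pos c' - C.pos c))
      C.terminals C.terminals.tail).prod

open Classical in
/-- The type `(Δ, 𝒢, 𝒟)` of a decorated connected diagram: the decoration of the first terminal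
chord; the multiset of pairs (decoration, gap to the preceding terminal chord) over the later
terminal chords; the multiset of the decorations different from `1` of non-terminal chords. -/
noncomputable def type (C : DecoratedDiagram) : ℕ × Multiset (ℕ × ℕ) × Multiset ℕ :=
  (C.deco C.firstTerminal,
    ((List.zipWith (fun c c' => (C.deco c', C.pos c' - C.pos c))
      C.terminals C.terminals.tail : List (ℕ × ℕ)) : Multiset (ℕ × ℕ)),
    (C.chords.filter fun c => ¬ C.IsTerminal c ∧ C.deco c ≠ 1).val.map C.deco)

end DecoratedDiagram

/-! ### Weighted generating functions -/

/-- The weighted generating function `∑_{C ∈ A} w(C) z^‖C‖ / ‖C‖!`. -/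
noncomputable def weightedGF (s : ℕ) (A : Set DecoratedDiagram) : PowerSeries ℚ :=
  PowerSeries.mk fun n =>
    ∑ C ∈ DecoratedDiagram.ofSize A n, (C.weight s : ℚ) / (n.factorial : ℚ)

/-- `F_{Δ, 𝒢, 𝒟}`: the weighted generating function of the connected diagrams of a given type. -/
noncomputable def typeGF (s Δ : ℕ) (𝒢 : Multiset (ℕ × ℕ)) (𝒟 : Multiset ℕ) : PowerSeries ℚ :=
  weightedGF s {C | C.IsConnected ∧ C.type = (Δ, 𝒢, 𝒟)}

/-- The connected diagrams with exactly one terminal chord and no chord of decoration `≥ 2`. -/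
def oneTerminalUndecorated : Set DecoratedDiagram :=
  {C | C.IsConnected ∧ (∃! c, C.IsTerminal c) ∧ ∀ c ∈ C.chords, ¬ 2 ≤ C.deco c}

/-- The formal power series `√(1 + c z)`, i.e. the binomial series of exponent `1/2` in `c z`. -/
noncomputable def sqrtSeries {K : Type*} [Field K] [CharZero K] (c : K) : PowerSeries K :=
  PowerSeries.rescale c (PowerSeries.binomialSeries K (1 / 2 : ℚ))

theorem sqrtSeries_sq {K : Type*} [Field K] [CharZero K] (c : K) :
    sqrtSeries c ^ 2 = 1 + PowerSeries.C c * PowerSeries.X := by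
  have h : PowerSeries.binomialSeries K (1 / 2 : ℚ) ^ 2 = 1 + PowerSeries.X := by
    rw [pow_two, ← PowerSeries.binomialSeries_add, show (1 / 2 + 1 / 2 : ℚ) = ((1 : ℕ) : ℚ) by
      norm_num, PowerSeries.binomialSeries_nat, pow_one]
  rw [sqrtSeries, ← map_pow, h, map_add, map_one, PowerSeries.rescale_X]

/-! ### Green functions

A Green function `G(x, L)` is a power series in the coupling `x` whose coefficients are polynomials
in the scale variable `L`. -/

/-- The next-to^k leading-log part `H_k(z) = ∑_i g_{i, i+k} z^i` of
`G(x, L) = 1 + ∑_{k ≥ 0} H_k(x L) x^k`, where `g_{i, n}` is the coefficient of `L^i x^n`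
in `G - 1`. The leading-log expansion is `H_0`. -/
noncomputable def logPart {K : Type*} [Field K] (k : ℕ) (G : PowerSeries (Polynomial K)) :
    PowerSeries K :=
  PowerSeries.mk fun i => (PowerSeries.coeff (i + k) (G - 1)).coeff i

/-- The power series in `ρ` obtained by dividing `e^{-Lρ} - 1` by `ρ`. -/
noncomputable def expQuot (K : Type*) [Field K] [CharZero K] : PowerSeries (Polynomial K) :=
  PowerSeries.mk fun m => PowerSeries.coeff (m + 1)
    (PowerSeries.rescale (-Polynomial.X) (PowerSeries.exp (Polynomial K)) - 1)

theorem X_mul_expQuot (K : Type*) [Field K] [CharZero K] :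
    PowerSeries.X * expQuot K =
      PowerSeries.rescale (-Polynomial.X) (PowerSeries.exp (Polynomial K)) - 1 := by
  ext1 n
  cases n with
  | zero =>
    rw [PowerSeries.coeff_zero_X_mul, map_sub, PowerSeries.coeff_rescale, PowerSeries.coeff_exp]
    simp
  | succ n => simp [PowerSeries.coeff_succ_X_mul, expQuot]

/-- The power series `(e^{-Lρ} - 1) F(ρ)` in `ρ`, for the Laurent series
`F(ρ) = ∑_{i ≥ 0} b_i ρ^{i-1}`: the product of `(e^{-Lρ} - 1) / ρ` and `ρ F(ρ)`. -/
noncomputable def integrand {K : Type*} [Field K] [CharZero K] (b : ℕ → K) :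
    PowerSeries (Polynomial K) :=
  expQuot K * PowerSeries.mk fun i => Polynomial.C (b i)

/-- The operator `∂_{-ρ} = -d/dρ` on power series in `ρ` with coefficients in `K[L]`. -/
noncomputable def negDeriv (K : Type*) [Field K] :
    Module.End K (PowerSeries (Polynomial K)) where
  toFun Φ := -PowerSeries.derivative (Polynomial K) Φ
  map_add' Φ Ψ := by rw [map_add, neg_add]
  map_smul' c Φ := by
    ext1 n
    simp [PowerSeries.coeff_derivative]

/-- `P(x, ∂_{-ρ}) Φ(ρ) |_{ρ = 0}`: in every coefficient (in `x`) of `P(x, L)`, the variable `L` is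
replaced by `∂_{-ρ}`, the operator is applied to `Φ`, and the result is evaluated at `ρ = 0`. -/
noncomputable def applyAtZero {K : Type*} [Field K] (P Φ : PowerSeries (Polynomial K)) :
    PowerSeries (Polynomial K) :=
  PowerSeries.mk fun n =>
    PowerSeries.constantCoeff (Polynomial.aeval (negDeriv K) (PowerSeries.coeff n P) Φ)

/-- `G` solves the Dyson–Schwinger equation
`G(x, L) = 1 - ∑_{k ≥ 1} x^k G(x, ∂_{-ρ})^{1 - s k} (e^{-Lρ} - 1) F_k(ρ) |_{ρ = 0}`,
where `F_k(ρ) = ∑_{i ≥ 0} a_{k, i} ρ^{i - 1}`. As `G` is raised to negative powers, it is taken in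
the group of invertible series. The equation is read coefficient by coefficient in `x`; the terms
with `k > n` do not contribute to the coefficient of `x^n`. -/
def IsDSESolution {K : Type*} [Field K] [CharZero K] (s : ℕ) (a : ℕ → ℕ → K)
    (G : (PowerSeries (Polynomial K))ˣ) : Prop :=
  ∀ n : ℕ, PowerSeries.coeff n (G : PowerSeries (Polynomial K)) =
    PowerSeries.coeff n (1 - ∑ k ∈ Finset.Icc 1 n, PowerSeries.X ^ k *
      applyAtZero ((G ^ (1 - (s : ℤ) * (k : ℤ)) : (PowerSeries (Polynomial K))ˣ) :
        PowerSeries (Polynomial K)) (integrand (a k)))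

/-- The chord diagram expansion
`1 - ∑_C (∑_{i=1}^{t₁(C)} a_{d(t₁(C)), t₁(C) - i} (-L)^i / i!) w(C) A(C) x^‖C‖`,
the sum being over all decorated connected diagrams `C`. -/
noncomputable def chordExpansion {K : Type*} [Field K] [CharZero K] (s : ℕ) (a : ℕ → ℕ → K) :
    PowerSeries (Polynomial K) :=
  1 - PowerSeries.mk fun n =>
    ∑ C ∈ DecoratedDiagram.ofSize {C | C.IsConnected} n,
      (∑ i ∈ Finset.Icc 1 C.t₁,
        Polynomial.C (a (C.deco C.firstTerminal) (C.t₁ - i) / (i.factorial : K)) *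
          (-Polynomial.X) ^ i) *
        Polynomial.C ((C.weight s : K) * C.monomialA a)

end ChordLog

open ChordLog

namespace ChordLog

/-! ### Counting the diagrams with one terminal chord -/

/-! For `s = 2` a chord of decoration 1 has weight factor binom(ω, ω) = 1, so the first series just
counts undecorated diagrams with one terminal chord. Delete the root `(1, b)` of such a diagram with
n + 1 chords, n ≥ 1. The remaining chords keep their terminal status, so what remains again has one
terminal chord, and the root must cross something. In a diagram with one terminal chord each of the
2n - 1 inner intervals lies below a chord, so exactly 2n - 1 positions of `b` are allowed
(`oneSinkMatchings_succ`). The counts therefore satisfy c(n+1) = (2n-1) c(n) with c(1) = 1, which is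
the coefficient recursion of the square root, obtained from 2(1+cz)g' = cg
(`coeff_succ_sqrtSeries`).

In the chord expansion the power of L is at most t₁(C), and t₁(C) ≤ number of chords ≤ ‖C‖. A term
in Lⁿxⁿ forces equality throughout: all decorations are 1 and the first terminal chord is the last
chord, hence the only terminal one. So the same count governs the leading logarithms.

The Dyson–Schwinger equation is treated independently of diagrams. Its right side at order xⁿ sees
only lower orders of G, which gives existence and uniqueness. By induction the degree in L is at
most the order in x, so taking leading coefficients is multiplicative, and only k = 1 and `a 1 0`
survive. With H the series of these coefficients (constant term 1 included), H' = a₁₀ H^(1-s). For s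
= 2 this says (H²)' = 2a₁₀, and H(0) = 1 selects the root. -/

/-- `S` is the set of chords of a chord diagram. -/
def IsMatching (S : Finset (ℕ × ℕ)) : Prop :=
  (∀ c ∈ S, c.1 < c.2) ∧
    S.image Prod.fst ∪ S.image Prod.snd = Finset.Icc 1 (2 * S.card)

/-- The chord `c` of `S` crosses no chord to its right. -/
def IsSink (S : Finset (ℕ × ℕ)) (c : ℕ × ℕ) : Prop :=
  c ∈ S ∧ ∀ d ∈ S, ¬ Crosses c d

/-- A chord crossing `c` from the left has a smaller first endpoint anyway, so only crossings to the
right can violate terminality. -/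
theorem ChordDiagram.isTerminal_iff (C : ChordDiagram) (c : ℕ × ℕ) :
    C.IsTerminal c ↔ IsSink C.chords c := by
  refine and_congr_right fun _ => forall₂_congr fun d _ => ⟨fun h hc => ?_, fun h hc => ?_⟩
  · exact lt_asymm (h (Or.inl hc)) hc.1
  · rcases hc with hc | hc
    · exact absurd hc h
    · exact hc.1

/-- The sets of `n` chords forming a diagram with exactly one terminal chord. -/
def oneSinkMatchings (n : ℕ) : Set (Finset (ℕ × ℕ)) :=
  {S | IsMatching S ∧ S.card = n ∧ ∃! c, IsSink S c}

namespace IsMatching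

variable {S : Finset (ℕ × ℕ)}

theorem mem_Icc (h : IsMatching S) {c : ℕ × ℕ} (hc : c ∈ S) :
    1 ≤ c.1 ∧ c.1 < c.2 ∧ c.2 ≤ 2 * S.card := by
  have h1 : c.1 ∈ Finset.Icc 1 (2 * S.card) := by
    rw [← h.2]
    exact Finset.mem_union_left _ (Finset.mem_image_of_mem _ hc)
  have h2 : c.2 ∈ Finset.Icc 1 (2 * S.card) := by
    rw [← h.2]
    exact Finset.mem_union_right _ (Finset.mem_image_of_mem _ hc)
  rw [Finset.mem_Icc] at h1 h2
  exact ⟨h1.1, h.1 c hc, h2.2⟩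

theorem exists_mem (h : IsMatching S) {x : ℕ} (h1 : 1 ≤ x) (h2 : x ≤ 2 * S.card) :
    ∃ c ∈ S, c.1 = x ∨ c.2 = x := by
  have hx : x ∈ Finset.Icc 1 (2 * S.card) := Finset.mem_Icc.2 ⟨h1, h2⟩
  rw [← h.2, Finset.mem_union, Finset.mem_image, Finset.mem_image] at hx
  rcases hx with ⟨c, hc, e⟩ | ⟨c, hc, e⟩
  exacts [⟨c, hc, Or.inl e⟩, ⟨c, hc, Or.inr e⟩]

/-- At most n first and at most n second endpoints must fill 2n dots, so no two endpoints can
coincide. -/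
theorem card_union (h : IsMatching S) :
    (S.image Prod.fst).card = S.card ∧ (S.image Prod.snd).card = S.card ∧
      Disjoint (S.image Prod.fst) (S.image Prod.snd) := by
  have h0 := congrArg Finset.card h.2
  rw [Nat.card_Icc] at h0
  have h1 := Finset.card_union_add_card_inter (S.image Prod.fst) (S.image Prod.snd)
  have h2 : (S.image Prod.fst).card ≤ S.card := Finset.card_image_le
  have h3 : (S.image Prod.snd).card ≤ S.card := Finset.card_image_le
  refine ⟨by omega, by omega, ?_⟩
  rw [Finset.disjoint_iff_inter_eq_empty, ← Finset.card_eq_zero]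
  omega

theorem fst_inj (h : IsMatching S) {c d : ℕ × ℕ} (hc : c ∈ S) (hd : d ∈ S) (e : c.1 = d.1) :
    c = d :=
  Finset.card_image_iff.1 h.card_union.1 hc hd e

theorem snd_inj (h : IsMatching S) {c d : ℕ × ℕ} (hc : c ∈ S) (hd : d ∈ S) (e : c.2 = d.2) :
    c = d :=
  Finset.card_image_iff.1 h.card_union.2.1 hc hd e

theorem fst_ne_snd (h : IsMatching S) {c d : ℕ × ℕ} (hc : c ∈ S) (hd : d ∈ S) : c.1 ≠ d.2 :=
  fun e => Finset.disjoint_left.1 h.card_union.2.2 (Finset.mem_image_of_mem _ hc)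
    (e ▸ Finset.mem_image_of_mem Prod.snd hd)

end IsMatching

/-- The chord with the largest right endpoint crosses nothing to its right. -/
theorem exists_isSink {S : Finset (ℕ × ℕ)} (h : S.Nonempty) : ∃ c, IsSink S c := by
  obtain ⟨c, hc, hmax⟩ := S.exists_max_image Prod.snd h
  exact ⟨c, hc, fun d hd hcd => absurd (hmax d hd) (not_le.2 hcd.2.2)⟩

/-- In a diagram with a single terminal chord every interval lies below a chord. -/
theorem exists_chord_above {S : Finset (ℕ × ℕ)} (h : IsMatching S) (hs : ∃! c, IsSink S c)
    {m : ℕ} (h1 : 1 ≤ m) (h2 : m < 2 * S.card) : ∃ d ∈ S, d.1 ≤ m ∧ m < d.2 := by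
  by_contra! hno
  obtain ⟨r, hr, hr1⟩ := h.exists_mem le_rfl (by omega : 1 ≤ 2 * S.card)
  have hr1' : r.1 = 1 := by
    have := h.mem_Icc hr
    omega
  have hrm : r ∈ S.filter fun c => c.2 ≤ m :=
    Finset.mem_filter.2 ⟨hr, hno r hr (by omega)⟩
  -- If nothing lies above the interval `m`, the diagram splits there. The chord ending last among
  -- those to the left of the cut is terminal, and so is the chord ending at the last dot: two
  -- terminal chords.
  obtain ⟨c, hc, hcmax⟩ := Finset.exists_max_image _ Prod.snd ⟨r, hrm⟩
  rw [Finset.mem_filter] at hc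
  have hcs : IsSink S c := by
    refine ⟨hc.1, fun d hd hcd => ?_⟩
    have hd2 : d.2 ≤ m := hno d hd (by have := hcd.2.1; omega)
    have := hcmax d (Finset.mem_filter.2 ⟨hd, hd2⟩)
    have := hcd.2.2
    omega
  obtain ⟨e, he, he1⟩ := h.exists_mem (by omega : 1 ≤ 2 * S.card) le_rfl
  have he2 : e.2 = 2 * S.card := by
    have := h.mem_Icc he
    omega
  have hes : IsSink S e := by
    refine ⟨he, fun d hd hed => ?_⟩
    have := h.mem_Icc hd
    have := hed.2.2
    omega
  have := hs.unique hcs hes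
  subst this
  omega

/-- A diagram with a single terminal chord is connected. -/
theorem reachable_of_unique_isSink {S : Finset (ℕ × ℕ)} (h : IsMatching S) {t : ℕ × ℕ}
    (ht : ∀ c, IsSink S c → c = t) {c : ℕ × ℕ} (hc : c ∈ S) :
    (intersectionGraph S).Reachable c t := by
  -- Follow crossings to the right: the first endpoint grows, so the walk stops, and it can only
  -- stop at the terminal chord.
  induction hk : 2 * S.card - c.1 using Nat.strong_induction_on generalizing c with
  | _ k ih =>
    by_cases hs : IsSink S c
    · rw [ht c hs]
    · have : ∃ d ∈ S, Crosses c d := by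
        by_contra! hno
        exact hs ⟨hc, hno⟩
      obtain ⟨d, hd, hcd⟩ := this
      have hadj : (intersectionGraph S).Adj c d := ⟨hc, hd, Or.inl hcd⟩
      have := h.mem_Icc hd
      have := hcd.1
      exact hadj.reachable.trans (ih _ (by omega) hd rfl)

/-! ### Insertion and deletion of the root chord -/

/-- The relabelling of the dots when a root chord `(1, b)` is inserted. -/
def dotShift (b x : ℕ) : ℕ := if x + 1 < b then x + 1 else x + 2

theorem dotShift_strictMono (b : ℕ) : StrictMono (dotShift b) := by
  intro x y hxy
  unfold dotShift
  split_ifs <;> omega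

/-- The relabelling of the endpoints of a chord when a root chord `(1, b)` is inserted. -/
def chordShift (b : ℕ) : ℕ × ℕ → ℕ × ℕ := Prod.map (dotShift b) (dotShift b)

theorem chordShift_injective (b : ℕ) : Function.Injective (chordShift b) :=
  (dotShift_strictMono b).injective.prodMap (dotShift_strictMono b).injective

theorem crosses_chordShift (b : ℕ) (c d : ℕ × ℕ) :
    Crosses (chordShift b c) (chordShift b d) ↔ Crosses c d := by
  simp [Crosses, chordShift, (dotShift_strictMono b).lt_iff_lt]

/-- Insertion of a root chord `(1, b)`. -/
def insertRoot (b : ℕ) (S : Finset (ℕ × ℕ)) : Finset (ℕ × ℕ) :=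
  insert (1, b) (S.image (chordShift b))

theorem two_le_chordShift {b : ℕ} {c : ℕ × ℕ} (hc : 1 ≤ c.1) :
    2 ≤ (chordShift b c).1 := by
  simp only [chordShift, Prod.map_fst, dotShift]
  split_ifs <;> omega

theorem endpoints_image (f : ℕ → ℕ) (S : Finset (ℕ × ℕ)) :
    (S.image (Prod.map f f)).image Prod.fst ∪ (S.image (Prod.map f f)).image Prod.snd =
      (S.image Prod.fst ∪ S.image Prod.snd).image f := by
  rw [Finset.image_union, Finset.image_image, Finset.image_image, Finset.image_image,
    Finset.image_image]
  rfl

theorem image_dotShift {b n : ℕ} (h2 : 2 ≤ b) (hb : b ≤ 2 * n + 2) :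
    (Finset.Icc 1 (2 * n)).image (dotShift b) = (Finset.Icc 1 (2 * (n + 1))) \ {1, b} := by
  ext x
  simp only [Finset.mem_image, Finset.mem_Icc, Finset.mem_sdiff, Finset.mem_insert,
    Finset.mem_singleton, dotShift]
  constructor
  · rintro ⟨y, hy, rfl⟩
    split_ifs <;> omega
  · rintro ⟨hx, hne⟩
    rcases lt_or_ge x b with h | h
    · exact ⟨x - 1, by omega, by rw [if_pos] <;> omega⟩
    · exact ⟨x - 2, by omega, by rw [if_neg] <;> omega⟩

theorem root_notMem_image {S : Finset (ℕ × ℕ)} (hS : ∀ c ∈ S, 1 ≤ c.1) {b : ℕ} :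
    (1, b) ∉ S.image (chordShift b) := by
  rw [Finset.mem_image]
  rintro ⟨c, hc, e⟩
  have := two_le_chordShift (b := b) (hS c hc)
  rw [e] at this
  simp at this

theorem card_insertRoot {S : Finset (ℕ × ℕ)} (hS : ∀ c ∈ S, 1 ≤ c.1) {b : ℕ} :
    (insertRoot b S).card = S.card + 1 := by
  rw [insertRoot, Finset.card_insert_of_notMem (root_notMem_image hS),
    Finset.card_image_of_injective _ (chordShift_injective b)]

theorem isMatching_insertRoot {S : Finset (ℕ × ℕ)} (h : IsMatching S) {b : ℕ} (h2 : 2 ≤ b)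
    (hb : b ≤ 2 * S.card + 2) : IsMatching (insertRoot b S) := by
  constructor
  · intro c hc
    rcases Finset.mem_insert.1 hc with rfl | hc
    · exact h2
    · obtain ⟨d, hd, rfl⟩ := Finset.mem_image.1 hc
      exact dotShift_strictMono b (h.1 d hd)
  · rw [card_insertRoot (fun c hc => (h.mem_Icc hc).1), insertRoot,
      Finset.image_insert, Finset.image_insert, Finset.insert_union, Finset.union_insert,
      chordShift, endpoints_image, h.2, image_dotShift h2 hb]
    ext x
    simp only [Finset.mem_insert, Finset.mem_sdiff, Finset.mem_Icc, Finset.mem_singleton]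
    omega

/-- Every nonempty diagram arises by insertion of a root. -/
theorem IsMatching.exists_eq_insertRoot {T : Finset (ℕ × ℕ)} (h : IsMatching T) {n : ℕ}
    (hn : T.card = n + 1) :
    ∃ b S, 2 ≤ b ∧ b ≤ 2 * n + 2 ∧ IsMatching S ∧ S.card = n ∧ insertRoot b S = T := by
  obtain ⟨⟨r, b⟩, hr, hr1⟩ := h.exists_mem le_rfl (by omega : 1 ≤ 2 * T.card)
  have hrb := h.mem_Icc hr
  simp only at hrb hr1
  obtain rfl : r = 1 := by omega
  have hb2 : 2 ≤ b := by omega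
  have hbn : b ≤ 2 * n + 2 := by omega
  have hrange : ∀ x, 1 ≤ x → x ≤ 2 * (n + 1) → x ≠ 1 → x ≠ b →
      ∃ y ∈ Finset.Icc 1 (2 * n), dotShift b y = x := by
    intro x h1 h2 h3 h4
    have : x ∈ (Finset.Icc 1 (2 * n)).image (dotShift b) := by
      rw [image_dotShift hb2 hbn]
      simp only [Finset.mem_insert, Finset.mem_sdiff, Finset.mem_Icc, Finset.mem_singleton]
      omega
    exact Finset.mem_image.1 this
  have hsub : ∀ c ∈ T.erase (1, b), c.1 ≠ 1 ∧ c.1 ≠ b ∧ c.2 ≠ 1 ∧ c.2 ≠ b := by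
    intro c hc
    obtain ⟨hne, hc⟩ := Finset.mem_erase.1 hc
    exact ⟨fun e => hne (h.fst_inj hc hr e), h.fst_ne_snd hc hr,
      fun e => h.fst_ne_snd hr hc e.symm, fun e => hne (h.snd_inj hc hr e)⟩
  have hT : ∃ S : Finset (ℕ × ℕ), S.image (chordShift b) = T.erase (1, b) := by
    have : (↑(T.erase (1, b)) : Set (ℕ × ℕ)) ⊆ chordShift b '' Set.univ := by
      intro c hc
      rw [Finset.mem_coe] at hc
      have h4 := hsub c hc
      have h5 := h.mem_Icc (Finset.mem_of_mem_erase hc)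
      obtain ⟨x, _, hx⟩ := hrange c.1 (by omega) (by omega) h4.1 h4.2.1
      obtain ⟨y, _, hy⟩ := hrange c.2 (by omega) (by omega) h4.2.2.1 h4.2.2.2
      exact ⟨(x, y), trivial, Prod.ext hx hy⟩
    obtain ⟨S, -, hS⟩ := Finset.subset_set_image_iff.1 this
    exact ⟨S, hS⟩
  obtain ⟨S, hS⟩ := hT
  have hins : ChordLog.insertRoot b S = T := by
    rw [ChordLog.insertRoot, hS, Finset.insert_erase hr]
  have hcard : S.card = n := by
    rw [← Finset.card_image_of_injective S (chordShift_injective b), hS,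
      Finset.card_erase_of_mem hr, hn, Nat.add_sub_cancel]
  refine ⟨b, S, hb2, hbn, ⟨?_, ?_⟩, hcard, hins⟩
  · intro c hc
    have : chordShift b c ∈ T.erase (1, b) := hS ▸ Finset.mem_image_of_mem _ hc
    exact (dotShift_strictMono b).lt_iff_lt.1 (h.1 _ (Finset.mem_of_mem_erase this))
  -- The endpoint sets are compared after relabelling, where both sides are the dots of `T` other
  -- than 1 and `b`.
  · apply Finset.image_injective (dotShift_strictMono b).injective
    rw [hcard, image_dotShift hb2 hbn, ← endpoints_image]
    change (S.image (chordShift b)).image _ ∪ (S.image (chordShift b)).image _ = _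
    rw [hS]
    ext x
    have hx := Finset.ext_iff.1 h.2 x
    rw [hn] at hx
    rw [Finset.mem_sdiff, ← hx]
    simp only [Finset.mem_union, Finset.mem_image, Finset.mem_insert, Finset.mem_singleton]
    constructor
    · rintro (⟨c, hc, rfl⟩ | ⟨c, hc, rfl⟩)
      · have := hsub c hc
        exact ⟨Or.inl ⟨c, Finset.mem_of_mem_erase hc, rfl⟩, by tauto⟩
      · have := hsub c hc
        exact ⟨Or.inr ⟨c, Finset.mem_of_mem_erase hc, rfl⟩, by tauto⟩
    · rintro ⟨⟨c, hc, rfl⟩ | ⟨c, hc, rfl⟩, hne⟩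
      · exact Or.inl ⟨c, Finset.mem_erase.2 ⟨by rintro rfl; simp at hne, hc⟩, rfl⟩
      · exact Or.inr ⟨c, Finset.mem_erase.2 ⟨by rintro rfl; simp at hne, hc⟩, rfl⟩

/-- The root starts left of every other chord, so it is never on the right of a crossing and cannot
spoil a sink. -/
theorem isSink_insertRoot_chordShift {S : Finset (ℕ × ℕ)} (hS : ∀ c ∈ S, 1 ≤ c.1) {b : ℕ}
    (c : ℕ × ℕ) : IsSink (insertRoot b S) (chordShift b c) ↔ IsSink S c := by
  have hmem : ∀ c, chordShift b c ∈ insertRoot b S ↔ c ∈ S := by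
    intro c
    rw [insertRoot, Finset.mem_insert, Finset.mem_image]
    constructor
    · rintro (h | ⟨d, hd, h⟩)
      · have h1 := congrArg Prod.fst h
        simp only [chordShift, Prod.map_fst, dotShift] at h1
        have h2 := congrArg Prod.snd h
        simp only [chordShift, Prod.map_snd, dotShift] at h2
        split_ifs at h1 h2 <;> omega
      · exact chordShift_injective b h ▸ hd
    · exact fun h => Or.inr ⟨c, h, rfl⟩
  constructor
  · rintro ⟨h1, h2⟩
    exact ⟨(hmem c).1 h1, fun d hd hcd =>
      h2 _ ((hmem d).2 hd) ((crosses_chordShift b c d).2 hcd)⟩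
  · rintro ⟨h1, h2⟩
    refine ⟨(hmem c).2 h1, fun d hd hcd => ?_⟩
    rcases Finset.mem_insert.1 hd with rfl | hd
    · have := two_le_chordShift (b := b) (hS c h1)
      have := hcd.1
      simp only at this
      omega
    · obtain ⟨e, he, rfl⟩ := Finset.mem_image.1 hd
      exact h2 e he ((crosses_chordShift b c e).1 hcd)

/-- In the old labels the right end of the root falls between the dots `b - 2` and `b - 1`, so the
root crosses exactly the chords above that interval. -/
theorem isSink_insertRoot_root {S : Finset (ℕ × ℕ)} (hS : ∀ c ∈ S, 1 ≤ c.1) {b : ℕ}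
    (hb : 2 ≤ b) :
    IsSink (insertRoot b S) (1, b) ↔ ∀ d ∈ S, ¬ (d.1 ≤ b - 2 ∧ b - 2 < d.2) := by
  have key : ∀ d ∈ S, Crosses (1, b) (chordShift b d) ↔ d.1 ≤ b - 2 ∧ b - 2 < d.2 := by
    intro d hd
    have := two_le_chordShift (b := b) (hS d hd)
    simp only [Crosses, chordShift, Prod.map_fst, Prod.map_snd, dotShift] at this ⊢
    split_ifs at this ⊢ <;> omega
  constructor
  · rintro ⟨_, h⟩ d hd hbd
    exact h _ (Finset.mem_insert_of_mem (Finset.mem_image_of_mem _ hd)) ((key d hd).2 hbd)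
  · intro h
    refine ⟨Finset.mem_insert_self _ _, fun d hd hcd => ?_⟩
    rcases Finset.mem_insert.1 hd with rfl | hd
    · exact lt_irrefl _ hcd.1
    · obtain ⟨e, he, rfl⟩ := Finset.mem_image.1 hd
      exact h e he ((key e he).1 hcd)

theorem oneSinkMatchings_succ {n : ℕ} (hn : 1 ≤ n) :
    oneSinkMatchings (n + 1) =
      (fun p : ℕ × Finset (ℕ × ℕ) => insertRoot p.1 p.2) ''
        (↑(Finset.Icc 3 (2 * n + 1)) ×ˢ oneSinkMatchings n) := by
  ext T
  constructor
  · rintro ⟨hT, hc, hs⟩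
    obtain ⟨b, S, hb2, hbn, hS, hSc, rfl⟩ := hT.exists_eq_insertRoot hc
    have hS1 : ∀ c ∈ S, 1 ≤ c.1 := fun c hc => (hS.mem_Icc hc).1
    -- Since n ≥ 1 the old diagram has a sink, which survives as the unique one; hence the root is
    -- not a sink.
    obtain ⟨t, ht⟩ := exists_isSink (S := S) (Finset.card_pos.1 (by omega))
    have ht' := (isSink_insertRoot_chordShift hS1 (b := b) t).2 ht
    have hroot : ¬ IsSink (insertRoot b S) (1, b) := by
      intro hr
      have := two_le_chordShift (b := b) (hS1 t ht.1)
      rw [hs.unique ht' hr] at this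
      simp at this
    rw [isSink_insertRoot_root hS1 hb2] at hroot
    push Not at hroot
    obtain ⟨d, hd, hd1, hd2⟩ := hroot
    have hdI := hS.mem_Icc hd
    refine ⟨(b, S), ⟨?_, hS, hSc, t, ht, fun c hc => ?_⟩, rfl⟩
    · simp only [Finset.coe_Icc, Set.mem_Icc]
      omega
    · exact chordShift_injective b
        (hs.unique ((isSink_insertRoot_chordShift hS1 c).2 hc) ht')
  · rintro ⟨⟨b, S⟩, ⟨hb, hS, hSc, hs⟩, rfl⟩
    simp only [Finset.coe_Icc, Set.mem_Icc] at hb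
    have hS1 : ∀ c ∈ S, 1 ≤ c.1 := fun c hc => (hS.mem_Icc hc).1
    have hb2 : 2 ≤ b := by omega
    refine ⟨isMatching_insertRoot hS hb2 (by omega), by rw [card_insertRoot hS1, hSc], ?_⟩
    -- The range 3 ≤ b ≤ 2n + 1 makes `b - 2` an inner interval of `S`; a chord above it is crossed
    -- by the root.
    obtain ⟨d, hd, hd'⟩ := exists_chord_above hS hs (m := b - 2) (by omega) (by omega)
    obtain ⟨t, ht, htu⟩ := hs
    refine ⟨chordShift b t, (isSink_insertRoot_chordShift hS1 t).2 ht, fun c hc => ?_⟩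
    rcases Finset.mem_insert.1 hc.1 with rfl | h
    · exact absurd hd' ((isSink_insertRoot_root hS1 hb2).1 hc d hd)
    · obtain ⟨c, -, rfl⟩ := Finset.mem_image.1 h
      rw [htu c ((isSink_insertRoot_chordShift hS1 c).1 hc)]

theorem injOn_insertRoot (n : ℕ) :
    Set.InjOn (fun p : ℕ × Finset (ℕ × ℕ) => insertRoot p.1 p.2)
      (↑(Finset.Icc 3 (2 * n + 1)) ×ˢ oneSinkMatchings n) := by
  rintro ⟨b, S⟩ ⟨hb, hS, hSc, -⟩ ⟨b', S'⟩ ⟨hb', hS', hSc', -⟩ h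
  simp only [Finset.coe_Icc, Set.mem_Icc] at hb hb' h
  have hS1 : ∀ c ∈ S, 1 ≤ c.1 := fun c hc => (hS.mem_Icc hc).1
  have hS1' : ∀ c ∈ S', 1 ≤ c.1 := fun c hc => (hS'.mem_Icc hc).1
  have hm := isMatching_insertRoot hS' (b := b') (by omega) (by omega)
  have h1 : (1, b) ∈ insertRoot b' S' := h ▸ Finset.mem_insert_self _ _
  have h2 : (1, b') ∈ insertRoot b' S' := Finset.mem_insert_self _ _
  obtain rfl : b = b' := congrArg Prod.snd (hm.fst_inj h1 h2 rfl)
  have h3 := congrArg (fun T => T.erase (1, b)) h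
  simp only [insertRoot, Finset.erase_insert (root_notMem_image hS1),
    Finset.erase_insert (root_notMem_image hS1')] at h3
  rw [Finset.image_injective (chordShift_injective b) h3]

theorem ncard_oneSinkMatchings_succ {n : ℕ} (hn : 1 ≤ n) :
    (oneSinkMatchings (n + 1)).ncard = (2 * n - 1) * (oneSinkMatchings n).ncard := by
  rw [oneSinkMatchings_succ hn, (injOn_insertRoot n).ncard_image, Set.ncard_prod,
    Set.ncard_coe_finset, Nat.card_Icc]
  congr 1

theorem oneSinkMatchings_zero : oneSinkMatchings 0 = ∅ := by
  ext S
  simp only [oneSinkMatchings, Set.mem_ofPred_eq, Set.mem_empty_iff_false, iff_false]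
  rintro ⟨-, h, c, hc, -⟩
  have := hc.1
  simp [Finset.card_eq_zero.1 h] at this

theorem oneSinkMatchings_one : oneSinkMatchings 1 = {{(1, 2)}} := by
  ext S
  rw [Set.mem_singleton_iff]
  constructor
  · rintro ⟨hS, h, -⟩
    obtain ⟨⟨x, y⟩, rfl⟩ := Finset.card_eq_one.1 h
    have := hS.mem_Icc (Finset.mem_singleton_self _)
    simp only [Finset.card_singleton] at this
    obtain rfl : x = 1 := by omega
    obtain rfl : y = 2 := by omega
    rfl
  · rintro rfl
    refine ⟨⟨by simp, by decide⟩, rfl, (1, 2), ⟨by simp, by simp [Crosses]⟩, ?_⟩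
    rintro c ⟨hc, -⟩
    exact Finset.mem_singleton.1 hc

end ChordLog

namespace ChordLog

/-! ### The intersection order -/

theorem fst_leftmost_le {S : Finset (ℕ × ℕ)} (h : S.Nonempty) {d : ℕ × ℕ} (hd : d ∈ S) :
    (leftmost S h).1 ≤ d.1 :=
  (S.exists_min_image Prod.fst h).choose_spec.2 d hd

theorem not_crosses_of_component {S : Finset (ℕ × ℕ)} {r c d : ℕ × ℕ} (hc : c ∈ component S r)
    (hd : d ∈ S \ component S r) : ¬ Crosses d c := by
  classical
  intro hcd
  obtain ⟨hd, hd'⟩ := Finset.mem_sdiff.1 hd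
  obtain ⟨hc, hr⟩ := Finset.mem_filter.1 hc
  have hadj : (intersectionGraph S).Adj c d := ⟨hc, hd, Or.inr hcd⟩
  exact hd' (Finset.mem_filter.2 ⟨hd, hr.trans hadj.reachable⟩)

/-- The intersection order lists every chord once, and a chord never precedes a chord that
crosses it from the left. -/
theorem intersectionOrder_spec (S : Finset (ℕ × ℕ)) :
    (∀ c, c ∈ intersectionOrder S ↔ c ∈ S) ∧ (intersectionOrder S).Nodup ∧
      (intersectionOrder S).Pairwise fun c d => ¬ Crosses d c := by
  induction hk : S.card using Nat.strong_induction_on generalizing S with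
  | _ k ih =>
    rw [intersectionOrder]
    split_ifs with h
    · set r := leftmost S h with hr
      have hrS : r ∈ S := leftmost_mem S h
      have hrc : r ∈ component S r := leftmost_mem_component S h
      have hsub := component_subset S r
      obtain ⟨m1, n1, p1⟩ := ih _ (hk ▸ (Finset.card_erase_lt_of_mem hrc).trans_le
        (Finset.card_le_card hsub)) ((component S r).erase r) rfl
      obtain ⟨m2, n2, p2⟩ := ih _ (hk ▸ Finset.card_lt_card (Finset.sdiff_ssubset hsub ⟨_, hrc⟩))
        (S \ component S r) rfl
      have hmem : ∀ c, c ∈ intersectionOrder ((component S r).erase r) ++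
          intersectionOrder (S \ component S r) ↔ c ≠ r ∧ c ∈ S := by
        intro c
        rw [List.mem_append, m1, m2, Finset.mem_erase, Finset.mem_sdiff]
        constructor
        · rintro (⟨h1, h2⟩ | ⟨h1, h2⟩)
          · exact ⟨h1, hsub h2⟩
          · exact ⟨fun e => h2 (e ▸ hrc), h1⟩
        · rintro ⟨h1, h2⟩
          by_cases h3 : c ∈ component S r
          exacts [Or.inl ⟨h1, h3⟩, Or.inr ⟨h2, h3⟩]
      refine ⟨fun c => ?_, ?_, ?_⟩
      · rw [List.mem_cons, hmem]
        constructor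
        · rintro (rfl | h1)
          exacts [hrS, h1.2]
        · intro h1
          by_cases h2 : c = r
          exacts [Or.inl h2, Or.inr ⟨h2, h1⟩]
      · rw [List.nodup_cons, List.nodup_append]
        refine ⟨fun h1 => ((hmem r).1 h1).1 rfl, n1, n2, fun c hc d hd e => ?_⟩
        rw [m1] at hc
        rw [m2, ← e] at hd
        exact (Finset.mem_sdiff.1 hd).2 (Finset.mem_of_mem_erase hc)
      · rw [List.pairwise_cons, List.pairwise_append]
        refine ⟨fun d hd hc => ?_, p1, p2, fun c hc d hd => ?_⟩
        -- Nothing crosses the root from the left, because it starts leftmost.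
        · exact absurd (fst_leftmost_le h ((hmem d).1 hd).2) (not_le.2 hc.1)
        · rw [m1] at hc
          rw [m2] at hd
          exact not_crosses_of_component (Finset.mem_of_mem_erase hc) hd
    · rw [Finset.not_nonempty_iff_eq_empty] at h
      simp [h]

theorem idxOf_headD_filter_le {α : Type*} [BEq α] [LawfulBEq α] (l : List α) (p : α → Bool) (x c : α)
    (hc : c ∈ l) (hp : p c) : l.idxOf ((l.filter p).headD x) ≤ l.idxOf c := by
  induction l with
  | nil => simp at hc
  | cons b l ih =>
    by_cases hb : p b
    · simp [hb]
    · have hbc : b ≠ c := by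
        rintro rfl
        exact hb hp
      have hcl : c ∈ l := (List.mem_cons.1 hc).resolve_left (Ne.symm hbc)
      rw [List.filter_cons_of_neg hb, List.idxOf_cons_ne _ hbc]
      by_cases he : b = (l.filter p).headD x
      · rw [← he, List.idxOf_cons_self]
        exact Nat.zero_le _
      · rw [List.idxOf_cons_ne _ he]
        exact Nat.succ_le_succ (ih hcl)

/-! ### Terminal chords and their positions -/

namespace ChordDiagram

variable (C : ChordDiagram)

theorem isMatching : IsMatching C.chords := ⟨C.lt, C.endpoints⟩

theorem mem_order {c : ℕ × ℕ} : c ∈ C.order ↔ c ∈ C.chords := (intersectionOrder_spec _).1 c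

theorem nodup_order : C.order.Nodup := (intersectionOrder_spec _).2.1

theorem length_order : C.order.length = C.chords.card := by
  rw [← List.toFinset_card_of_nodup C.nodup_order]
  congr 1
  ext c
  rw [List.mem_toFinset, C.mem_order]

theorem mem_terminals {c : ℕ × ℕ} : c ∈ C.terminals ↔ C.IsTerminal c := by
  classical
  simp only [terminals, List.mem_filter, C.mem_order, decide_eq_true_iff]
  exact ⟨fun h => h.2, fun h => ⟨h.1, h⟩⟩

theorem nodup_terminals : C.terminals.Nodup := C.nodup_order.filter _

theorem pos_le_card {c : ℕ × ℕ} (hc : c ∈ C.chords) : C.pos c ≤ C.chords.card := by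
  rw [← C.length_order]
  exact List.idxOf_lt_length_iff.2 (C.mem_order.2 hc)

theorem pos_injOn {c d : ℕ × ℕ} (hc : c ∈ C.chords) (h : C.pos c = C.pos d) : c = d :=
  (List.idxOf_inj (C.mem_order.2 hc)).1 (Nat.succ_injective h)

/-- The last chord in the intersection order is terminal. -/
theorem exists_isTerminal_pos_eq (h : C.chords.Nonempty) :
    ∃ c, C.IsTerminal c ∧ C.pos c = C.chords.card := by
  have hlen : 0 < C.order.length := by
    rw [C.length_order]
    exact Finset.card_pos.2 h
  have hlt : C.order.length - 1 < C.order.length := by omega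
  refine ⟨C.order[C.order.length - 1], ?_, ?_⟩
  · rw [isTerminal_iff]
    refine ⟨C.mem_order.1 (List.getElem_mem hlt), fun d hd hc => ?_⟩
    obtain ⟨i, hi, rfl⟩ := List.getElem_of_mem (C.mem_order.2 hd)
    rcases Nat.lt_or_ge i (C.order.length - 1) with h1 | h1
    · exact List.pairwise_iff_getElem.1 (intersectionOrder_spec C.chords).2.2 i
        (C.order.length - 1) hi hlt h1 hc
    · obtain rfl : i = C.order.length - 1 := by omega
      exact lt_irrefl _ hc.1
  · rw [pos, C.nodup_order.idxOf_getElem, ← C.length_order]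
    omega

theorem isTerminal_firstTerminal (h : C.chords.Nonempty) : C.IsTerminal C.firstTerminal := by
  obtain ⟨c, hc, -⟩ := C.exists_isTerminal_pos_eq h
  rw [← mem_terminals] at hc ⊢
  rw [firstTerminal]
  cases hl : C.terminals with
  | nil => simp [hl] at hc
  | cons b l => simp

theorem pos_firstTerminal_le {c : ℕ × ℕ} (hc : C.IsTerminal c) :
    C.pos C.firstTerminal ≤ C.pos c :=
  Nat.succ_le_succ (idxOf_headD_filter_le _ _ _ _ (C.mem_order.2 hc.1) (by classical exact decide_eq_true hc))

/-- The last chord is always terminal; if the first terminal chord already sits in the last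
position, there is no room for another. -/
theorem existsUnique_isTerminal_iff (h : C.chords.Nonempty) :
    (∃! c, C.IsTerminal c) ↔ C.pos C.firstTerminal = C.chords.card := by
  obtain ⟨t, ht, htp⟩ := C.exists_isTerminal_pos_eq h
  constructor
  · intro hu
    rw [hu.unique (C.isTerminal_firstTerminal h) ht, htp]
  · refine fun hp => ⟨_, C.isTerminal_firstTerminal h, fun c hc => ?_⟩
    apply C.pos_injOn hc.1
    have := C.pos_firstTerminal_le hc
    have := C.pos_le_card hc.1
    omega

theorem terminals_eq_singleton {c : ℕ × ℕ} (hc : C.IsTerminal c)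
    (hu : ∀ d, C.IsTerminal d → d = c) : C.terminals = [c] := by
  have hn := C.nodup_terminals
  have hm : ∀ d, d ∈ C.terminals ↔ d = c := fun d =>
    C.mem_terminals.trans ⟨hu d, fun e => e ▸ hc⟩
  refine List.perm_singleton.1 ((List.perm_ext_iff_of_nodup hn (List.nodup_singleton c)).2 ?_)
  simpa using hm

theorem isConnected_of_existsUnique (h : ∃! c, C.IsTerminal c) : C.IsConnected := by
  obtain ⟨t, ht, hu⟩ := h
  refine ⟨⟨t, ht.1⟩, fun c hc d hd => ?_⟩
  have hu' : ∀ c, IsSink C.chords c → c = t := fun c hc => hu c ((C.isTerminal_iff c).2 hc)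
  exact (reachable_of_unique_isSink C.isMatching hu' hc).trans
    (reachable_of_unique_isSink C.isMatching hu' hd).symm

end ChordDiagram

/-! ### The generating function of diagrams with one terminal chord -/

namespace DecoratedDiagram

theorem mem_ofSize {A : Set DecoratedDiagram} {n : ℕ} {C : DecoratedDiagram} :
    C ∈ ofSize A n ↔ C ∈ A ∧ C.size = n := by
  simp [ofSize]

theorem deco_eq_one {C : DecoratedDiagram} (h : ∀ c ∈ C.chords, ¬ 2 ≤ C.deco c) {c : ℕ × ℕ}
    (hc : c ∈ C.chords) : C.deco c = 1 := by
  have := C.deco_pos c hc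
  have := h c hc
  omega

theorem size_eq_card {C : DecoratedDiagram} (h : ∀ c ∈ C.chords, ¬ 2 ≤ C.deco c) :
    C.size = C.chords.card := by
  rw [size, Finset.sum_congr rfl fun c hc => deco_eq_one h hc, Finset.card_eq_sum_ones]

theorem deco_le_one_of_size_eq_card {C : DecoratedDiagram} (h : C.size = C.chords.card) :
    ∀ c ∈ C.chords, ¬ 2 ≤ C.deco c := by
  intro c hc h2
  have : ∑ c ∈ C.chords, 1 < ∑ c ∈ C.chords, C.deco c :=
    Finset.sum_lt_sum (fun d hd => C.deco_pos d hd) ⟨c, hc, h2⟩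
  rw [← Finset.card_eq_sum_ones, ← h] at this
  exact lt_irrefl _ this

/-- For `s = 2` the undecorated diagrams have weight one. -/
theorem weight_two_eq_one {C : DecoratedDiagram} (h : ∀ c ∈ C.chords, ¬ 2 ≤ C.deco c) :
    C.weight 2 = 1 := by
  refine Finset.prod_eq_one fun c hc => ?_
  -- With d = 1 and s = 2 the upper index d·s + ω - 2 is exactly ω.
  rw [deco_eq_one h hc, one_mul, Nat.add_sub_cancel_left, Nat.choose_self]

/-- The decorated diagram with all decorations `1`. -/
def ofMatching (S : Finset (ℕ × ℕ)) (h : IsMatching S) : DecoratedDiagram where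
  chords := S
  lt := h.1
  endpoints := h.2
  deco c := if c ∈ S then 1 else 0
  deco_pos c hc := by simp [hc]
  deco_eq_zero c hc := by simp [hc]

/-- The decoration is forced to be 1 on chords and connectedness is automatic, so such a diagram is
determined by its chord set. -/
theorem card_ofSize_oneTerminalUndecorated (n : ℕ) :
    (ofSize oneTerminalUndecorated n).card = (oneSinkMatchings n).ncard := by
  rw [← Set.ncard_coe_finset]
  have hinj : Set.InjOn (fun C : DecoratedDiagram => C.chords)
      (ofSize oneTerminalUndecorated n : Set DecoratedDiagram) := by
    intro C hC D hD h
    simp only [Finset.mem_coe, mem_ofSize] at hC hD h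
    refine DecoratedDiagram.ext h (funext fun c => ?_)
    by_cases hc : c ∈ C.chords
    · rw [deco_eq_one hC.1.2.2 hc, deco_eq_one hD.1.2.2 (h ▸ hc)]
    · rw [C.deco_eq_zero c hc, D.deco_eq_zero c (h ▸ hc)]
  rw [← hinj.ncard_image]
  congr 1
  ext S
  constructor
  · rintro ⟨C, hC, rfl⟩
    simp only [Finset.mem_coe, mem_ofSize] at hC
    obtain ⟨⟨-, hu, hd⟩, hn⟩ := hC
    refine ⟨C.isMatching, by rw [← hn, size_eq_card hd], ?_⟩
    simpa only [C.isTerminal_iff] using hu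
  · rintro ⟨hS, hn, hu⟩
    have hd : ∀ c ∈ (ofMatching S hS).chords, ¬ 2 ≤ (ofMatching S hS).deco c := by
      intro c hc
      have hc' : c ∈ S := hc
      simp [ofMatching, hc']
    have hu' : ∃! c, (ofMatching S hS).IsTerminal c := by
      simp only [ChordDiagram.isTerminal_iff]
      exact hu
    refine ⟨ofMatching S hS, ?_, rfl⟩
    rw [Finset.mem_coe, mem_ofSize, size_eq_card hd]
    exact ⟨⟨ChordDiagram.isConnected_of_existsUnique _ hu', hu', hd⟩, hn⟩

theorem zipWith_tail_eq_nil_iff {α β : Type*} (f : α → α → β) (l : List α) :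
    List.zipWith f l l.tail = [] ↔ l.length ≤ 1 := by
  rcases l with _ | ⟨b, _ | ⟨c, l⟩⟩ <;> simp

/-- The list of gaps is empty exactly when there is at most one terminal chord, and the last
multiset is empty exactly when every non-terminal decoration is 1. -/
theorem isConnected_and_type_iff (C : DecoratedDiagram) :
    C.IsConnected ∧ C.type = (1, 0, 0) ↔ C ∈ oneTerminalUndecorated := by
  classical
  constructor
  · rintro ⟨hC, ht⟩
    simp only [type, Prod.mk.injEq, Multiset.coe_eq_zero, zipWith_tail_eq_nil_iff,
      Multiset.map_eq_zero, Finset.val_eq_zero, Finset.filter_eq_empty_iff] at ht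
    obtain ⟨h1, h2, h3⟩ := ht
    have hf := C.isTerminal_firstTerminal hC.1
    have hu : ∀ c, C.IsTerminal c → c = C.firstTerminal := by
      intro c hc
      rw [← C.mem_terminals] at hc hf
      generalize C.terminals = l at *
      rcases l with _ | ⟨b, _ | ⟨d, l⟩⟩
      · simp at hc
      · rw [List.mem_singleton] at hc hf
        rw [hc, hf]
      · simp at h2
    refine ⟨hC, ⟨_, hf, hu⟩, fun c hc => ?_⟩
    by_cases hct : C.IsTerminal c
    · rw [hu c hct, h1]
      norm_num
    · have := h3 hc
      push Not at this
      rw [this hct]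
      norm_num
  · rintro ⟨hC, ⟨t, ht, hu⟩, hd⟩
    refine ⟨hC, ?_⟩
    rw [type, C.terminals_eq_singleton ht hu,
      deco_eq_one hd (C.isTerminal_firstTerminal hC.1).1]
    simp only [List.tail_cons, List.zipWith_nil_right, Multiset.coe_nil, Prod.mk.injEq,
      Multiset.map_eq_zero, Finset.val_eq_zero, Finset.filter_eq_empty_iff, true_and]
    exact fun c hc h => h.2 (deco_eq_one hd hc)

end DecoratedDiagram

/-! ### Coefficients of the square root series -/

section Sqrt

variable {K : Type*} [Field K] [CharZero K]

theorem constantCoeff_sqrtSeries (c : K) :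
    PowerSeries.constantCoeff (sqrtSeries c) = 1 := by
  rw [sqrtSeries, ← PowerSeries.coeff_zero_eq_constantCoeff_apply, PowerSeries.coeff_rescale,
    PowerSeries.binomialSeries_coeff, Ring.choose_zero_right]
  simp

theorem coeff_succ_sqrtSeries (c : K) (n : ℕ) :
    2 * ((n : K) + 1) * PowerSeries.coeff (n + 1) (sqrtSeries c) =
      c * (1 - 2 * n) * PowerSeries.coeff n (sqrtSeries c) := by
  set g := sqrtSeries c with hg
  have h1 := sqrtSeries_sq c
  rw [← hg] at h1
  have h2 := congrArg (PowerSeries.derivative K) h1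
  rw [pow_two, Derivation.leibniz, map_add, Derivation.leibniz, PowerSeries.derivative_C,
    PowerSeries.derivative_X, Derivation.map_one_eq_zero] at h2
  simp only [smul_eq_mul, mul_one, mul_zero, add_zero, zero_add] at h2
  -- Multiply 2gg' = c by g and replace g² by 1 + cz, giving a linear equation for g.
  have h3 : 2 * ((1 + PowerSeries.C c * PowerSeries.X) * PowerSeries.derivative K g) =
      PowerSeries.C c * g := by
    linear_combination (-2 * PowerSeries.derivative K g) * h1 + g * h2
  have h4 := congrArg (PowerSeries.coeff n) h3
  rw [add_mul, one_mul, mul_assoc, two_mul, map_add, map_add, PowerSeries.coeff_C_mul,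
    PowerSeries.coeff_C_mul, PowerSeries.coeff_derivative] at h4
  cases n with
  | zero =>
    rw [PowerSeries.coeff_zero_X_mul] at h4
    simp only [Nat.cast_zero] at h4 ⊢
    linear_combination h4
  | succ n =>
    rw [PowerSeries.coeff_succ_X_mul, PowerSeries.coeff_derivative] at h4
    push_cast at h4 ⊢
    linear_combination h4

/-- Consecutive coefficients have ratio (-c/2)(2n-1)/(n+1), and 2n - 1 is also the ratio of the
diagram counts. -/
theorem coeff_sqrtSeries (c : K) {n : ℕ} (hn : 1 ≤ n) :
    PowerSeries.coeff n (sqrtSeries c) =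
      -((-c / 2) ^ n * (oneSinkMatchings n).ncard / (n.factorial : K)) := by
  induction n, hn using Nat.le_induction with
  | base =>
    have h := coeff_succ_sqrtSeries c 0
    rw [PowerSeries.coeff_zero_eq_constantCoeff_apply, constantCoeff_sqrtSeries] at h
    simp only [Nat.cast_zero, zero_add, mul_one, mul_zero, sub_zero] at h
    rw [oneSinkMatchings_one, Set.ncard_singleton]
    simp only [pow_one, Nat.cast_one, mul_one, Nat.factorial_one, div_one]
    linear_combination h / 2
  | succ n hn ih =>
    have h := coeff_succ_sqrtSeries c n
    have h0 : (n : K) + 1 ≠ 0 := by exact_mod_cast Nat.succ_ne_zero n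
    have h1 : (n.factorial : K) ≠ 0 := by exact_mod_cast n.factorial_ne_zero
    rw [ih] at h
    rw [ncard_oneSinkMatchings_succ hn, Nat.factorial_succ]
    push_cast [Nat.cast_sub (by omega : 1 ≤ 2 * n)]
    have h2 : PowerSeries.coeff (n + 1) (sqrtSeries c) = c * (1 - 2 * n) *
        -((-c / 2) ^ n * (oneSinkMatchings n).ncard / (n.factorial : K)) / (2 * ((n : K) + 1)) := by
      rw [eq_div_iff (by simpa using h0), ← h]
      ring
    rw [h2]
    field_simp
    ring

end Sqrt

theorem weightedGF_oneTerminalUndecorated :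
    weightedGF 2 oneTerminalUndecorated = 1 - sqrtSeries (-2 : ℚ) := by
  ext n
  rw [weightedGF, PowerSeries.coeff_mk, Finset.sum_congr rfl fun C hC => by
    rw [DecoratedDiagram.weight_two_eq_one (DecoratedDiagram.mem_ofSize.1 hC).1.2.2],
    Finset.sum_const, DecoratedDiagram.card_ofSize_oneTerminalUndecorated, map_sub]
  rcases Nat.eq_zero_or_pos n with rfl | hn
  · rw [oneSinkMatchings_zero, PowerSeries.coeff_zero_eq_constantCoeff_apply,
      PowerSeries.coeff_zero_eq_constantCoeff_apply, constantCoeff_sqrtSeries]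
    simp
  · rw [coeff_sqrtSeries _ hn, PowerSeries.coeff_one, if_neg hn.ne']
    simp only [nsmul_eq_mul]
    norm_num
    ring

theorem typeGF_one_zero_zero : typeGF 2 1 0 0 = 1 - sqrtSeries (-2 : ℚ) := by
  rw [← weightedGF_oneTerminalUndecorated, typeGF]
  congr 1
  ext C
  exact C.isConnected_and_type_iff

/-! ### The leading logarithms of the chord diagram expansion -/

theorem monomialA_eq_pow {K : Type*} [Field K] (a : ℕ → ℕ → K) {C : DecoratedDiagram} (hC : C ∈ oneTerminalUndecorated) :
    C.monomialA a = a 1 0 ^ (C.size - 1) := by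
  classical
  obtain ⟨-, ⟨t, ht, hu⟩, hd⟩ := hC
  rw [DecoratedDiagram.monomialA, C.terminals_eq_singleton ht hu]
  have hf : C.chords.filter (fun c => ¬ C.IsTerminal c) = C.chords.erase t := by
    ext c
    rw [Finset.mem_filter, Finset.mem_erase, and_comm]
    refine and_congr_left fun _ => not_congr ⟨hu c, fun e => e ▸ ht⟩
  rw [List.tail_cons, List.zipWith_nil_right, List.prod_nil, mul_one]
  rw [Finset.prod_congr (g := fun _ => a 1 0) (s₂ := C.chords.erase t)
    (by rw [← hf]) fun c hc => by
      rw [DecoratedDiagram.deco_eq_one hd (Finset.mem_of_mem_erase hc)]]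
  rw [Finset.prod_const, Finset.card_erase_of_mem ht.1, DecoratedDiagram.size_eq_card hd]

theorem coeff_sum_C_mul_neg_X_pow {K : Type*} [Field K] (b : ℕ → K) (t n : ℕ) :
    (∑ i ∈ Finset.Icc 1 t, Polynomial.C (b i) * (-Polynomial.X) ^ i).coeff n =
      if n ∈ Finset.Icc 1 t then b n * (-1) ^ n else 0 := by
  rw [Polynomial.finsetSum_coeff, ← Finset.sum_ite_eq (Finset.Icc 1 t) n fun i => b i * (-1) ^ i]
  refine Finset.sum_congr rfl fun i _ => ?_
  rw [neg_pow, Polynomial.coeff_C_mul, show (-1 : Polynomial K) ^ i = Polynomial.C ((-1) ^ i) by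
    simp, Polynomial.coeff_C_mul, Polynomial.coeff_X_pow]
  split_ifs with h
  · rw [mul_one]
  · simp

section Expansion

variable {K : Type*} [Field K] [CharZero K] (a : ℕ → ℕ → K)

/-- A diagram contributes to Lⁿxⁿ only if t₁(C) = ‖C‖ = n, which singles out the undecorated
diagrams with one terminal chord; each of them contributes the same amount. -/
theorem logPart_zero_chordExpansion :
    logPart 0 (chordExpansion 2 a) = sqrtSeries (2 * a 1 0) - 1 := by
  ext n
  rw [logPart, PowerSeries.coeff_mk, add_zero, chordExpansion, sub_sub_cancel_left, map_neg,
    PowerSeries.coeff_mk, Polynomial.coeff_neg, Polynomial.finsetSum_coeff, map_sub]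
  have hsub : DecoratedDiagram.ofSize oneTerminalUndecorated n ⊆
      DecoratedDiagram.ofSize {C | C.IsConnected} n := by
    intro C hC
    rw [DecoratedDiagram.mem_ofSize] at hC ⊢
    exact ⟨hC.1.1, hC.2⟩
  rw [← Finset.sum_subset hsub]
  · rcases Nat.eq_zero_or_pos n with rfl | hn
    · rw [show DecoratedDiagram.ofSize oneTerminalUndecorated 0 = ∅ from Finset.card_eq_zero.1 (by
        rw [DecoratedDiagram.card_ofSize_oneTerminalUndecorated, oneSinkMatchings_zero,
          Set.ncard_empty]), PowerSeries.coeff_zero_eq_constantCoeff_apply,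
        PowerSeries.coeff_zero_eq_constantCoeff_apply, constantCoeff_sqrtSeries]
      simp
    · rw [coeff_sqrtSeries _ hn, PowerSeries.coeff_one, if_neg hn.ne', sub_zero, neg_inj,
        Finset.sum_congr rfl (g := fun _ => a 1 0 / (n.factorial : K) * (-1) ^ n * a 1 0 ^ (n - 1)),
        Finset.sum_const, DecoratedDiagram.card_ofSize_oneTerminalUndecorated, nsmul_eq_mul]
      · rw [neg_div, mul_div_cancel_left₀ _ (two_ne_zero' K), neg_pow (a 1 0)]
        obtain ⟨m, rfl⟩ : ∃ m, n = m + 1 := ⟨n - 1, by omega⟩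
        rw [Nat.add_sub_cancel, pow_succ (a 1 0)]
        ring
      · intro C hC
        obtain ⟨hC, hs⟩ := DecoratedDiagram.mem_ofSize.1 hC
        have hcard := DecoratedDiagram.size_eq_card hC.2.2
        have ht : C.t₁ = n := by
          rw [← hs, hcard]
          exact (C.existsUnique_isTerminal_iff hC.1.1).1 hC.2.1
        rw [Polynomial.coeff_mul_C, coeff_sum_C_mul_neg_X_pow, ht,
          if_pos (Finset.mem_Icc.2 ⟨hn, le_rfl⟩), Nat.sub_self, monomialA_eq_pow a hC,
          DecoratedDiagram.weight_two_eq_one hC.2.2, hs, DecoratedDiagram.deco_eq_one hC.2.2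
            (C.isTerminal_firstTerminal hC.1.1).1, Nat.cast_one, one_mul]
  -- In the chain t₁ ≤ number of chords ≤ size = n, a power Lⁿ would force equality everywhere and
  -- put `C` in the smaller family.
  · intro C hC hC'
    obtain ⟨hc, hs⟩ := DecoratedDiagram.mem_ofSize.1 hC
    have hc' : C.IsConnected := hc
    have h1 : C.t₁ ≤ C.chords.card :=
      C.pos_le_card (C.isTerminal_firstTerminal hc'.1).1
    have h2 := C.card_le_size
    rw [Polynomial.coeff_mul_C, coeff_sum_C_mul_neg_X_pow, if_neg, zero_mul]
    intro hn
    rw [Finset.mem_Icc] at hn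
    refine hC' (DecoratedDiagram.mem_ofSize.2 ⟨⟨hc', ?_, ?_⟩, hs⟩)
    · exact (C.existsUnique_isTerminal_iff hc'.1).2
        (show C.t₁ = C.chords.card by omega)
    · exact DecoratedDiagram.deco_le_one_of_size_eq_card (by omega)

end Expansion

end ChordLog

namespace ChordLog

open PowerSeries

/-! ### Existence and uniqueness of the solution of the Dyson–Schwinger equation -/

/-- Agreement below order n is equality modulo Xⁿ, and a ring quotient respects integer powers of
units, negative ones included. -/
theorem coeff_zpow_congr {R : Type*} [CommRing R] {u v : R⟦X⟧ˣ} {n : ℕ}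
    (h : ∀ m < n, coeff m (u : R⟦X⟧) = coeff m (v : R⟦X⟧)) (j : ℤ) :
    ∀ m < n, coeff m ((u ^ j : R⟦X⟧ˣ) : R⟦X⟧) = coeff m ((v ^ j : R⟦X⟧ˣ) : R⟦X⟧) := by
  let f : R⟦X⟧ →* R⟦X⟧ ⧸ Ideal.span {(X : R⟦X⟧) ^ n} := (Ideal.Quotient.mk _).toMonoidHom
  have hf : ∀ φ ψ : R⟦X⟧, f φ = f ψ ↔ ∀ m < n, coeff m φ = coeff m ψ := by
    intro φ ψ
    change Ideal.Quotient.mk _ φ = Ideal.Quotient.mk _ ψ ↔ _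
    rw [Ideal.Quotient.eq, Ideal.mem_span_singleton, X_pow_dvd_iff]
    simp only [map_sub, sub_eq_zero]
  have huv : Units.map f u = Units.map f v := Units.ext ((hf _ _).2 h)
  refine (hf _ _).1 ?_
  have := congrArg (fun w => ((w ^ j : (R⟦X⟧ ⧸ Ideal.span {(X : R⟦X⟧) ^ n})ˣ) :
    R⟦X⟧ ⧸ Ideal.span {(X : R⟦X⟧) ^ n})) huv
  simpa only [← map_zpow, Units.coe_map] using this

section DysonSchwinger

variable {K : Type*} [Field K] [CharZero K] (s : ℕ) (a : ℕ → ℕ → K)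

/-- The right hand side of the Dyson–Schwinger equation. -/
noncomputable def dseRHS (G : (Polynomial K)⟦X⟧ˣ) : (Polynomial K)⟦X⟧ :=
  mk fun n => coeff n (1 - ∑ k ∈ Finset.Icc 1 n, X ^ k *
    applyAtZero ((G ^ (1 - (s : ℤ) * (k : ℤ)) : (Polynomial K)⟦X⟧ˣ) : (Polynomial K)⟦X⟧)
      (integrand (a k)))

theorem isDSESolution_iff (G : (Polynomial K)⟦X⟧ˣ) :
    IsDSESolution s a G ↔ (G : (Polynomial K)⟦X⟧) = dseRHS s a G := by
  rw [PowerSeries.ext_iff]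
  simp only [dseRHS, coeff_mk]
  rfl

theorem coeff_dseRHS (G : (Polynomial K)⟦X⟧ˣ) (n : ℕ) :
    coeff n (dseRHS s a G) = coeff n (1 : (Polynomial K)⟦X⟧) - ∑ k ∈ Finset.Icc 1 n,
      constantCoeff (Polynomial.aeval (negDeriv K)
        (coeff (n - k) ((G ^ (1 - (s : ℤ) * (k : ℤ)) : (Polynomial K)⟦X⟧ˣ) : (Polynomial K)⟦X⟧))
          (integrand (a k))) := by
  rw [dseRHS, coeff_mk, map_sub, map_sum]
  congr 1
  refine Finset.sum_congr rfl fun k hk => ?_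
  rw [coeff_X_pow_mul', if_pos (Finset.mem_Icc.1 hk).2, applyAtZero, coeff_mk]

theorem constantCoeff_dseRHS (G : (Polynomial K)⟦X⟧ˣ) :
    constantCoeff (dseRHS s a G) = 1 := by
  rw [← coeff_zero_eq_constantCoeff_apply, coeff_dseRHS]
  simp

/-- The factor xᵏ with k ≥ 1 delays the dependence on `G` by at least one order: the right side is a
contraction in the X-adic sense. -/
theorem coeff_dseRHS_congr {G H : (Polynomial K)⟦X⟧ˣ} {n : ℕ}
    (h : ∀ m < n, coeff m (G : (Polynomial K)⟦X⟧) = coeff m (H : (Polynomial K)⟦X⟧)) :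
    coeff n (dseRHS s a G) = coeff n (dseRHS s a H) := by
  rw [coeff_dseRHS, coeff_dseRHS]
  congr 1
  refine Finset.sum_congr rfl fun k hk => ?_
  rw [coeff_zpow_congr h _ (n - k) (by have := Finset.mem_Icc.1 hk; omega)]

theorem exists_unit_eq_of_constantCoeff_eq_one {R : Type*} [CommRing R] {φ : R⟦X⟧}
    (h : constantCoeff φ = 1) : ∃ u : R⟦X⟧ˣ, (u : R⟦X⟧) = φ :=
  isUnit_iff_constantCoeff.2 (h ▸ isUnit_one)

theorem existsUnique_isDSESolution : ∃! G : (Polynomial K)⟦X⟧ˣ, IsDSESolution s a G := by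
  choose step hstep using fun G =>
    exists_unit_eq_of_constantCoeff_eq_one (constantCoeff_dseRHS s a G)
  -- Fixed-point iteration from 1: the coefficient of order m is stable from the iterate m + 1 on,
  -- and the limit collects these stable values.
  let u : ℕ → (Polynomial K)⟦X⟧ˣ := fun i => step^[i] 1
  have hu : ∀ i, (u (i + 1) : (Polynomial K)⟦X⟧) = dseRHS s a (u i) := by
    intro i
    simp only [u, Function.iterate_succ_apply', hstep]
  have hstab : ∀ i, ∀ m < i, coeff m (u (i + 1) : (Polynomial K)⟦X⟧) = coeff m (u i : _) := by
    intro i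
    induction i with
    | zero => exact fun m hm => absurd hm (Nat.not_lt_zero m)
    | succ i ih =>
      intro m hm
      rw [hu (i + 1), hu i]
      exact coeff_dseRHS_congr s a fun l hl => ih l (by omega)
  have hlim : ∀ m i, m < i →
      coeff m (u i : (Polynomial K)⟦X⟧) = coeff m (u (m + 1) : (Polynomial K)⟦X⟧) := by
    intro m i hi
    induction i, hi using Nat.le_induction with
    | base => rfl
    | succ i hi ih => rw [hstab i m hi, ih]
  obtain ⟨G, hG⟩ := exists_unit_eq_of_constantCoeff_eq_one
    (φ := mk fun m => coeff m (u (m + 1) : (Polynomial K)⟦X⟧)) (by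
      rw [← coeff_zero_eq_constantCoeff_apply, coeff_mk, hu, coeff_zero_eq_constantCoeff_apply,
        constantCoeff_dseRHS])
  have hGc : ∀ m, coeff m (G : (Polynomial K)⟦X⟧) = coeff m (u (m + 1) : (Polynomial K)⟦X⟧) := by
    intro m
    rw [hG, coeff_mk]
  refine ⟨G, (isDSESolution_iff s a G).2 (PowerSeries.ext fun n => ?_), fun H hH => ?_⟩
  · rw [hGc, hu]
    exact coeff_dseRHS_congr s a fun m hm => by rw [hGc, hlim m n hm]
  · have hGs : (G : (Polynomial K)⟦X⟧) = dseRHS s a G := PowerSeries.ext fun n => by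
      rw [hGc, hu]
      exact coeff_dseRHS_congr s a fun m hm => by rw [hGc, hlim m n hm]
    replace hH := (isDSESolution_iff s a H).1 hH
    refine Units.ext (PowerSeries.ext fun n => ?_)
    induction n using Nat.strong_induction_on with
    | _ n ih =>
      rw [hH, hGs]
      exact coeff_dseRHS_congr s a ih

end DysonSchwinger

/-! ### Leading logarithms -/

section LeadingLog

variable {R : Type*} [CommRing R]

/-- Up to order `x^N`, the degree in `L` is at most the degree in `x`. -/
def LogBounded (N : ℕ) (F : (Polynomial R)⟦X⟧) : Prop :=
  ∀ n < N, (coeff n F).natDegree ≤ n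

/-- The leading-log part: the coefficients of `L^n x^n`. -/
noncomputable def leadingLog (F : (Polynomial R)⟦X⟧) : R⟦X⟧ :=
  mk fun n => (coeff n F).coeff n

theorem logBounded_one (N : ℕ) : LogBounded N (1 : (Polynomial R)⟦X⟧) := by
  intro n _
  rw [coeff_one]
  split_ifs <;> simp

theorem LogBounded.mul {N : ℕ} {F G : (Polynomial R)⟦X⟧} (hF : LogBounded N F)
    (hG : LogBounded N G) : LogBounded N (F * G) := by
  intro n hn
  rw [coeff_mul]
  refine Polynomial.natDegree_sum_le_of_forall_le _ _ fun p hp => ?_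
  have hp' := Finset.HasAntidiagonal.mem_antidiagonal.1 hp
  refine Polynomial.natDegree_mul_le.trans ?_
  have h1 := hF p.1 (by omega)
  have h2 := hG p.2 (by omega)
  omega

theorem LogBounded.pow {N : ℕ} {F : (Polynomial R)⟦X⟧} (hF : LogBounded N F) (j : ℕ) :
    LogBounded N (F ^ j) := by
  induction j with
  | zero =>
    rw [pow_zero]
    exact logBounded_one N
  | succ j ih =>
    rw [pow_succ]
    exact ih.mul hF

/-- With constant coefficient 1, each coefficient of the inverse is minus a sum of products of
earlier ones with coefficients of `u`, whose orders add up correctly. -/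
theorem LogBounded.inv {N : ℕ} {u : (Polynomial R)⟦X⟧ˣ} (hu : LogBounded N (u : (Polynomial R)⟦X⟧))
    (h1 : constantCoeff (u : (Polynomial R)⟦X⟧) = 1) :
    LogBounded N ((u⁻¹ : (Polynomial R)⟦X⟧ˣ) : (Polynomial R)⟦X⟧) := by
  intro n
  induction n using Nat.strong_induction_on with
  | _ n ih =>
    intro hn
    have h := congrArg (coeff n) u.mul_inv
    rw [coeff_mul] at h
    cases n with
    | zero =>
      rw [Finset.Nat.antidiagonal_zero, Finset.sum_singleton, coeff_zero_eq_constantCoeff_apply, h1,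
        one_mul] at h
      rw [h]
      simp
    | succ n =>
      rw [Finset.Nat.sum_antidiagonal_succ, coeff_zero_eq_constantCoeff_apply, h1, one_mul,
        coeff_one, if_neg n.succ_ne_zero] at h
      rw [eq_neg_of_add_eq_zero_left h, Polynomial.natDegree_neg]
      refine Polynomial.natDegree_sum_le_of_forall_le _ _ fun p hp => ?_
      have hp' := Finset.HasAntidiagonal.mem_antidiagonal.1 hp
      refine Polynomial.natDegree_mul_le.trans ?_
      have h2 := hu (p.1 + 1) (by omega)
      have h3 := ih p.2 (by omega) (by omega)
      exact (Nat.add_le_add h2 h3).trans (by omega)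

theorem LogBounded.zpow {N : ℕ} {u : (Polynomial R)⟦X⟧ˣ}
    (hu : LogBounded N (u : (Polynomial R)⟦X⟧))
    (h1 : constantCoeff (u : (Polynomial R)⟦X⟧) = 1) (j : ℤ) :
    LogBounded N ((u ^ j : (Polynomial R)⟦X⟧ˣ) : (Polynomial R)⟦X⟧) := by
  obtain ⟨m, rfl | rfl⟩ := j.eq_nat_or_neg
  · rw [zpow_natCast, Units.val_pow_eq_pow_val]
    exact hu.pow m
  · rw [zpow_neg, zpow_natCast, ← inv_pow, Units.val_pow_eq_pow_val]
    exact (hu.inv h1).pow m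

/-- Under the degree bound, Lⁿ in a product of orders p + q = n can only come from Lᵖ times L^q. -/
theorem leadingLog_mul {F G : (Polynomial R)⟦X⟧} (hF : ∀ N, LogBounded N F)
    (hG : ∀ N, LogBounded N G) : leadingLog (F * G) = leadingLog F * leadingLog G := by
  ext n
  rw [leadingLog, coeff_mk, coeff_mul, coeff_mul, Polynomial.finsetSum_coeff]
  refine Finset.sum_congr rfl fun p hp => ?_
  rw [leadingLog, leadingLog, coeff_mk, coeff_mk, ← Finset.HasAntidiagonal.mem_antidiagonal.1 hp]
  exact Polynomial.coeff_mul_add_eq_of_natDegree_le (hF _ _ (Nat.lt_succ_self _))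
    (hG _ _ (Nat.lt_succ_self _))

theorem leadingLog_one : leadingLog (1 : (Polynomial R)⟦X⟧) = 1 := by
  ext n
  rw [leadingLog, coeff_mk, coeff_one, coeff_one]
  split_ifs with h <;> simp [h]

theorem logPart_zero {K : Type*} [Field K] (G : (Polynomial K)⟦X⟧) :
    logPart 0 G = leadingLog G - 1 := by
  rw [← leadingLog_one]
  ext n
  simp [logPart, leadingLog]

end LeadingLog

/-! ### The operator in `ρ` and the leading-log differential equation -/

section Operator

variable {K : Type*} [Field K]

theorem constantCoeff_negDeriv_pow (i : ℕ) (Φ : (Polynomial K)⟦X⟧) :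
    constantCoeff ((negDeriv K ^ i) Φ) = Polynomial.C ((-1) ^ i * (i.factorial : K)) * coeff i Φ := by
  induction i generalizing Φ with
  | zero => simp
  | succ i ih =>
    rw [pow_succ, Module.End.mul_apply, ih]
    change _ * coeff i (-derivative (Polynomial K) Φ) = _
    rw [map_neg, coeff_derivative, Nat.factorial_succ]
    simp only [map_mul, map_pow, map_neg, map_one, map_natCast]
    push_cast
    ring

theorem constantCoeff_aeval_negDeriv (P : Polynomial K) (Φ : (Polynomial K)⟦X⟧) {j : ℕ}
    (hP : P.natDegree ≤ j) :
    constantCoeff (Polynomial.aeval (negDeriv K) P Φ) = ∑ i ∈ Finset.range (j + 1),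
      Polynomial.C (P.coeff i * ((-1) ^ i * (i.factorial : K))) * coeff i Φ := by
  rw [Polynomial.aeval_eq_sum_range' (Nat.lt_succ_of_le hP), LinearMap.sum_apply, map_sum]
  refine Finset.sum_congr rfl fun i _ => ?_
  rw [LinearMap.smul_apply, ← coeff_zero_eq_constantCoeff_apply]
  change P.coeff i • coeff 0 ((negDeriv K ^ i) Φ) = _
  rw [coeff_zero_eq_constantCoeff_apply, constantCoeff_negDeriv_pow, Polynomial.smul_eq_C_mul,
    map_mul Polynomial.C (P.coeff i), mul_assoc]

variable [CharZero K]

theorem coeff_expQuot (m : ℕ) :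
    coeff m (expQuot K) =
      Polynomial.C ((-1) ^ (m + 1) / ((m + 1).factorial : K)) * Polynomial.X ^ (m + 1) := by
  rw [expQuot, coeff_mk, map_sub, coeff_rescale, coeff_exp, coeff_one, if_neg m.succ_ne_zero,
    sub_zero, neg_pow, IsScalarTower.algebraMap_apply ℚ K (Polynomial K), map_div₀, map_one,
    map_natCast, Polynomial.algebraMap_eq, div_eq_mul_one_div ((-1 : K) ^ (m + 1)),
    map_mul Polynomial.C, map_pow Polynomial.C, map_neg Polynomial.C, map_one Polynomial.C]
  ring

/-- The ρᵐ coefficient of the exponential quotient is a multiple of L^(m+1), so the top power of L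
meets only the residue `b 0`. -/
theorem coeff_integrand (b : ℕ → K) (i : ℕ) :
    (coeff i (integrand b)).natDegree ≤ i + 1 ∧
      (coeff i (integrand b)).coeff (i + 1) = (-1) ^ (i + 1) / ((i + 1).factorial : K) * b 0 := by
  have h : coeff i (integrand b) = ∑ p ∈ Finset.HasAntidiagonal.antidiagonal i,
      Polynomial.C ((-1) ^ (p.1 + 1) / ((p.1 + 1).factorial : K) * b p.2) *
        Polynomial.X ^ (p.1 + 1) := by
    rw [integrand, coeff_mul]
    refine Finset.sum_congr rfl fun p _ => ?_
    rw [coeff_expQuot, coeff_mk, map_mul Polynomial.C]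
    ring
  rw [h]
  constructor
  · refine Polynomial.natDegree_sum_le_of_forall_le _ _ fun p hp => ?_
    have := Finset.HasAntidiagonal.mem_antidiagonal.1 hp
    exact (Polynomial.natDegree_C_mul_X_pow_le _ _).trans (by omega)
  · rw [Polynomial.finsetSum_coeff, Finset.sum_eq_single_of_mem (i, 0) (by simp)]
    · rw [Polynomial.coeff_C_mul_X_pow, if_pos rfl]
    · intro p hp hne
      have := Finset.HasAntidiagonal.mem_antidiagonal.1 hp
      rw [Polynomial.coeff_C_mul_X_pow, if_neg]
      intro e
      exact hne (Prod.ext (by simp only; omega) (by simp only; omega))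

/-- The operator of degree `j` in `∂_{-ρ}` raises the degree in `L` to at most `j + 1`. -/
theorem aeval_negDeriv_integrand (b : ℕ → K) (P : Polynomial K) {j : ℕ} (hP : P.natDegree ≤ j) :
    (constantCoeff (Polynomial.aeval (negDeriv K) P (integrand b))).natDegree ≤ j + 1 ∧
      (constantCoeff (Polynomial.aeval (negDeriv K) P (integrand b))).coeff (j + 1) =
        -(P.coeff j * b 0 / ((j : K) + 1)) := by
  rw [constantCoeff_aeval_negDeriv P _ hP]
  constructor
  · refine Polynomial.natDegree_sum_le_of_forall_le _ _ fun i hi => ?_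
    have := Finset.mem_range.1 hi
    exact (Polynomial.natDegree_C_mul_le _ _).trans
      ((coeff_integrand b i).1.trans (by omega))
  -- Only i = j reaches L^(j+1); there (-1)ʲ j! times (-1)^(j+1)/(j+1)! is -1/(j+1), as in
  -- integration in L up to sign.
  · rw [Polynomial.finsetSum_coeff, Finset.sum_eq_single_of_mem j (by simp)]
    · rw [Polynomial.coeff_C_mul, (coeff_integrand b j).2, Nat.factorial_succ]
      have h0 : (j : K) + 1 ≠ 0 := by exact_mod_cast j.succ_ne_zero
      have h1 : (j.factorial : K) ≠ 0 := by exact_mod_cast j.factorial_ne_zero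
      have h2 : ((-1 : K) ^ j) * (-1) ^ j = 1 := by rw [← mul_pow]; simp
      push_cast
      rw [pow_succ]
      field_simp
      linear_combination (-(P.coeff j * b 0)) * h2
    · intro i hi hne
      have := Finset.mem_range.1 hi
      rw [Polynomial.coeff_C_mul, Polynomial.coeff_eq_zero_of_natDegree_lt (p := coeff i _)
        ((coeff_integrand b i).1.trans_lt (by omega)), mul_zero]

variable {s : ℕ} {a : ℕ → ℕ → K} {G : (Polynomial K)⟦X⟧ˣ}

theorem IsDSESolution.constantCoeff_eq_one (h : IsDSESolution s a G) :
    constantCoeff (G : (Polynomial K)⟦X⟧) = 1 := by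
  rw [(isDSESolution_iff s a G).1 h, constantCoeff_dseRHS]

theorem IsDSESolution.logBounded (h : IsDSESolution s a G) (N : ℕ) :
    LogBounded N (G : (Polynomial K)⟦X⟧) := by
  intro n _
  induction n using Nat.strong_induction_on with
  | _ n ih =>
    have hb : LogBounded n (G : (Polynomial K)⟦X⟧) := fun m hm => ih m hm (by omega)
    rw [(isDSESolution_iff s a G).1 h, coeff_dseRHS]
    refine (Polynomial.natDegree_sub_le_of_le (m := n) (n := n) (logBounded_one (R := K) (n + 1) n n.lt_succ_self)
      (Polynomial.natDegree_sum_le_of_forall_le _ _ fun k hk => ?_)).trans_eq (max_self n)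
    have := Finset.mem_Icc.1 hk
    -- The operator adds one degree in L, and k ≥ 1 pays for it: (n - k) + 1 ≤ n.
    exact (aeval_negDeriv_integrand (a k) _
      (hb.zpow h.constantCoeff_eq_one _ (n - k) (by omega))).1.trans (by omega)

/-- The differential equation of the leading-log expansion. -/
theorem IsDSESolution.derivative_leadingLog (h : IsDSESolution s a G) :
    derivative K (leadingLog (G : (Polynomial K)⟦X⟧)) = C (a 1 0) *
      leadingLog ((G ^ (1 - (s : ℤ)) : (Polynomial K)⟦X⟧ˣ) : (Polynomial K)⟦X⟧) := by
  ext n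
  have hz := fun (j : ℤ) m => (h.logBounded (m + 1)).zpow h.constantCoeff_eq_one j m m.lt_succ_self
  have h0 : (n : K) + 1 ≠ 0 := by exact_mod_cast n.succ_ne_zero
  rw [coeff_derivative, coeff_C_mul, leadingLog, leadingLog, coeff_mk, coeff_mk,
    (isDSESolution_iff s a G).1 h, coeff_dseRHS, coeff_one, if_neg n.succ_ne_zero, zero_sub,
    Polynomial.coeff_neg, Polynomial.finsetSum_coeff,
    Finset.sum_eq_single_of_mem 1 (Finset.mem_Icc.2 ⟨le_rfl, by omega⟩),
    Nat.add_sub_cancel, (aeval_negDeriv_integrand (a 1) _ (hz _ n)).2, Nat.cast_one, mul_one]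
  · field_simp
  -- For k ≥ 2 the degree in L is at most n + 2 - k ≤ n, so these terms miss L^(n+1).
  · intro k hk hne
    have := Finset.mem_Icc.1 hk
    refine Polynomial.coeff_eq_zero_of_natDegree_lt
      ((aeval_negDeriv_integrand (a k) _ (hz _ (n + 1 - k))).1.trans_lt (by omega))

theorem IsDSESolution.logPart_zero_of_two (h : IsDSESolution 2 a G) :
    logPart 0 (G : (Polynomial K)⟦X⟧) = sqrtSeries (2 * a 1 0) - 1 := by
  rw [logPart_zero]
  congr 1
  set H := leadingLog (G : (Polynomial K)⟦X⟧) with hH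
  have hd : derivative K H = C (a 1 0) *
      leadingLog ((G⁻¹ : (Polynomial K)⟦X⟧ˣ) : (Polynomial K)⟦X⟧) := by
    rw [hH, h.derivative_leadingLog, show (1 - ((2 : ℕ) : ℤ)) = -1 by norm_num, zpow_neg_one]
  have hinv : H * leadingLog ((G⁻¹ : (Polynomial K)⟦X⟧ˣ) : (Polynomial K)⟦X⟧) = 1 := by
    rw [hH, ← leadingLog_mul h.logBounded
      (fun N => (h.logBounded N).inv h.constantCoeff_eq_one), Units.mul_inv, leadingLog_one]
  have h0 : constantCoeff H = 1 := by
    rw [hH, ← coeff_zero_eq_constantCoeff_apply, leadingLog, coeff_mk,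
      coeff_zero_eq_constantCoeff_apply, h.constantCoeff_eq_one, Polynomial.coeff_one_zero]
  have hsq : H ^ 2 = sqrtSeries (2 * a 1 0) ^ 2 := by
    rw [sqrtSeries_sq]
    -- In characteristic 0 a series is determined by its derivative and constant term; here (H²)' =
    -- 2HH' = 2a₁₀ since H' = a₁₀/H.
    apply derivative.ext
    · rw [pow_two, Derivation.leibniz, map_add, Derivation.leibniz, derivative_C, derivative_X,
        Derivation.map_one_eq_zero, hd]
      simp only [smul_eq_mul, map_mul, map_ofNat]
      linear_combination (2 * C (a 1 0)) * hinv
    · simp [h0]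
  -- The negative root is excluded by the constant terms, both equal to 1.
  rcases eq_or_eq_neg_of_sq_eq_sq _ _ hsq with e | e
  · exact e
  · have := congrArg constantCoeff e
    rw [h0, map_neg, constantCoeff_sqrtSeries] at this
    norm_num at this

end Operator

end ChordLog

theorem proposition4p1 {K : Type*} [Field K] [CharZero K] (a : ℕ → ℕ → K) :
    -- the generating function of diagrams
    (weightedGF 2 oneTerminalUndecorated = 1 - sqrtSeries (-2 : ℚ) ∧
      typeGF 2 1 0 0 = 1 - sqrtSeries (-2 : ℚ)) ∧
    -- the leading-log expansion of the solution of the Dyson–Schwinger equation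
    ((∃! G : (PowerSeries (Polynomial K))ˣ, IsDSESolution 2 a G) ∧
      ∀ G : (PowerSeries (Polynomial K))ˣ, IsDSESolution 2 a G →
        logPart 0 (G : PowerSeries (Polynomial K)) = sqrtSeries (2 * a 1 0) - 1) ∧
    -- the leading-log expansion of the chord diagram expansion
    logPart 0 (chordExpansion 2 a) = sqrtSeries (2 * a 1 0) - 1 :=
  ⟨⟨weightedGF_oneTerminalUndecorated, typeGF_one_zero_zero⟩,
    ⟨existsUnique_isDSESolution 2 a, fun _ h => h.logPart_zero_of_two⟩,
    logPart_zero_chordExpansion a⟩
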